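/- Let $(W,S)$ be a Coxeter system with Coxeter matrix $(m_{st})$ and $W$ finite. Let $\mathfrak h^*=\bigoplus_{s\in S}\mathbb R\alpha_s$ be its geometric representation, with $(\alpha_s,\alpha_t)=-\cos(\pi/m_{st})$, $\langle\lambda,\alpha_s^\vee\rangle=2(\lambda,\alpha_s)/(\alpha_s,\alpha_s)$ and $s(\lambda)=\lambda-\langle\lambda,\alpha_s^\vee\rangle\alpha_s$. Let $R=\mathrm{Sym}(\mathfrak h^*)$ with the induced $W$-action, and let $R^W\subseteq R$ be the subalgebra of invariants. The nil Hecke algebra $\mathrm{nh}$ is the $\mathbb R$-algebra generated by the vector space $\mathfrak h^*$ and elements $\partial_s$ ($s\in S$), with relations $\lambda\mu=\mu\lambda$, $\partial_s\lambda=s(\lambda)\partial_s+\langle\lambda,\alpha_s^\vee\rangle$, $\partial_s^2=0$ and $\partial_s\partial_t\partial_s\cdots=\partial_t\partial_s\partial_t\cdots$ ($m_{st}$ factors on each side). Regard $\mathrm{nh}$ as a left $R$-module through $R\to\mathrm{nh}$, and write $s=1-\alpha_s\partial_s\in\mathrm{nh}$. A (left) bialgebroid structure on a ring $H\supseteq R$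 consists of left $R$-linear maps $\Delta:H\to H\otimes_R H$ (tensor product of left $R$-modules) and $\varepsilon:H\to R$ such that $(H,\Delta,\varepsilon)$ is a coassociative counital coalgebra; $\Delta$ is a ring homomorphism into the Takeuchi product $\{\sum h_i\otimes h_i' : \sum h_ir\otimes h_i'=\sum h_i\otimes h_i'r\ \forall r\in R\}$ with componentwise multiplication; and $h\cdot r=\varepsilon(hr)$ makes $R$ a left $H$-module extending the regular $R$-module. Then $H\text{-}\mathbf{Mod}$ is monoidal, with tensor product $M\otimes_R N$ on which $h(m\otimes n)=\sum h_{(1)}m\otimes h_{(2)}n$, and with unit $R$; if $\Delta$ is cocommutative, it is symmetric with the flip as braiding. Then the following hold. (1) There are an algebra homomorphism $\rho:\mathrm{nh}\to\mathrm{End}_{R^W}(R)$ with $\rho(\lambda)(f)=\lambda f$ and $\alpha_s\,\rho(\partial_s)(f)=f-s(f)$, and a cocommutative $R$-bialgebroid structure on $\mathrm{nh}$ with $\Delta(\lambda)=\lambda\otimes1$, $\Delta(\partial_s)=\partial_s\otimes s+1\otimes\partial_s$ and $\varepsilon(h)=\rho(h)(1)$. (Both are determined by these formulas.) (2) The map $\rho$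 is bijective and carries $\Delta$ to the comultiplication of the endomorphism algebra: if $\Delta(h)=\sum_i x_i\otimes y_i$, then $\rho(h)(fg)=\sum_i\rho(x_i)(f)\,\rho(y_i)(g)$ for all $f,g\in R$. (3) The functor $R\otimes_{R^W}-:R^W\text{-}\mathbf{Mod}\to\mathrm{nh}\text{-}\mathbf{Mod}$, where $\mathrm{nh}$ acts on the factor $R$ through $\rho$, is an equivalence of categories, and it is a (strong) symmetric monoidal functor from $(R^W\text{-}\mathbf{Mod},\otimes_{R^W})$ to $\mathrm{nh}\text{-}\mathbf{Mod}$ with the symmetric monoidal structure that comes from the bialgebroid structure in (1). -/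

import Mathlib

open CategoryTheory MonoidalCategory TensorProduct

universe u v

noncomputable section

section Takeuchi

variable {R H : Type*} [CommRing R] [Ring H] [Module R H]
variable {M N : Type*} [AddCommGroup M] [Module R M] [Module H M] [IsScalarTower R H M]
  [AddCommGroup N] [Module R N] [Module H N] [IsScalarTower R H N]

variable (R H) in
/-- The left `R`-linear map `h ↦ h • m`. -/
def orbitMap (m : M) : H →ₗ[R] M where
  toFun h := h • m
  map_add' := fun a b => add_smul a b m
  map_smul' := fun r a => smul_assoc r a m

@[simp] theorem orbitMap_apply (m : M) (h : H) : orbitMap R H m h = h • m := rfl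

theorem orbitMap_add (m m' : M) : orbitMap R H (m + m') = orbitMap R H m + orbitMap R H m' := by
  ext h; simp

variable [IsScalarTower R H H]

variable (R H) in
/-- The Takeuchi product `H ×_R H`: the elements `∑ hᵢ ⊗ hᵢ'` of the tensor product of left
`R`-modules such that `∑ hᵢ r ⊗ hᵢ' = ∑ hᵢ ⊗ hᵢ' r` for all `r`. The ring `R` maps to `H` by
`r ↦ r • 1`, which is a ring homomorphism because of `IsScalarTower R H H`. -/
def takeuchi : Submodule R (H ⊗[R] H) where
  carrier := {x | ∀ r : R, (LinearMap.mulRight R (r • (1 : H))).rTensor H x =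
    (LinearMap.mulRight R (r • (1 : H))).lTensor H x}
  zero_mem' r := by simp
  add_mem' hx hy r := by rw [map_add, map_add, hx r, hy r]
  smul_mem' c x hx r := by rw [map_smul, map_smul, hx r]

theorem orbitMap_smul (r : R) (m : M) :
    orbitMap R H (r • m) = orbitMap R H m ∘ₗ LinearMap.mulRight R (r • (1 : H)) := by
  ext h; simp [mul_smul]

/-- The action of the Takeuchi product on `M ⊗[R] N` for left `H`-modules `M` and `N`, given by
`(∑ hᵢ ⊗ hᵢ') (m ⊗ n) = ∑ hᵢ m ⊗ hᵢ' n`. For `M = N = H` it is the componentwise product. -/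
def takeuchiAct (x : takeuchi R H) : M ⊗[R] N →+ M ⊗[R] N :=
  TensorProduct.liftAddHom
    { toFun := fun m =>
        { toFun := fun n => TensorProduct.map (orbitMap R H m) (orbitMap R H n) x.1
          map_zero' := by
            have : orbitMap R H (0 : N) = 0 := by ext; simp
            simp [this]
          map_add' := fun n n' => by
            rw [orbitMap_add, TensorProduct.map_add_right, LinearMap.add_apply] }
      map_zero' := by
        have : orbitMap R H (0 : M) = 0 := by ext; simp
        ext; simp [this]
      map_add' := fun m m' => by
        ext n
        simp [orbitMap_add, TensorProduct.map_add_left] }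
    (fun r m n => by
      have h := congrArg (TensorProduct.map (orbitMap R H m) (orbitMap R H n)) (x.2 r)
      rw [← LinearMap.comp_apply, ← LinearMap.comp_apply, LinearMap.map_comp_rTensor,
        LinearMap.map_comp_lTensor, ← orbitMap_smul, ← orbitMap_smul] at h
      exact h)

@[simp] theorem takeuchiAct_tmul (x : takeuchi R H) (m : M) (n : N) :
    takeuchiAct x (m ⊗ₜ[R] n) = TensorProduct.map (orbitMap R H m) (orbitMap R H n) x.1 := rfl

end Takeuchi

/-- A left bialgebroid structure on `H` over the commutative ring `R`, where `R` maps to `H` by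
`r ↦ r • 1`; this map is injective by `counit_smul_one`. The comultiplication and the counit are
left `R`-linear and form a coassociative counital coalgebra, the comultiplication is a ring
homomorphism into the Takeuchi product, and `h ↦ (r ↦ ε (h r))` is a representation of `H` on `R`
that extends the regular representation of `R`. -/
structure Bialgebroid (R : Type*) (H : Type*) [CommRing R] [Ring H] [Module R H]
    [IsScalarTower R H H] extends Coalgebra R H where
  comul_mem : ∀ h, comul h ∈ takeuchi R H
  comul_one : comul 1 = 1 ⊗ₜ[R] 1
  comul_mul : ∀ g h, comul (g * h) = takeuchiAct ⟨comul g, comul_mem g⟩ (comul h)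
  counit_mul : ∀ g h (r : R), counit (g * h * (r • (1 : H))) =
    counit (g * (counit (h * (r • (1 : H))) • (1 : H)))
  counit_smul_one : ∀ r r' : R, counit ((r • (1 : H)) * (r' • (1 : H))) = r * r'

namespace Bialgebroid

/-- The comultiplication is invariant under the flip. -/
class IsCocomm {R H : Type*} [CommRing R] [Ring H] [Module R H]
    [IsScalarTower R H H] (bd : Bialgebroid R H) : Prop where
  comm_comul : ∀ h, TensorProduct.comm R H H (bd.comul h) = bd.comul h

section Unbundled

variable {R H : Type*} [CommRing R] [Ring H] [Module R H] [IsScalarTower R H H]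
  (bd : Bialgebroid R H)
variable (M N : Type*) [AddCommGroup M] [Module R M] [Module H M] [IsScalarTower R H M]
  [AddCommGroup N] [Module R N] [Module H N] [IsScalarTower R H N]

/-- The comultiplication as a map into the Takeuchi product. -/
def comulT (h : H) : takeuchi R H := ⟨bd.comul h, bd.comul_mem h⟩

theorem act_act (x : takeuchi R H) (y : H ⊗[R] H) (m : M) (n : N) :
    takeuchiAct x (TensorProduct.map (orbitMap R H m) (orbitMap R H n) y) =
      TensorProduct.map (orbitMap R H m) (orbitMap R H n) (takeuchiAct x y) := by
  induction y with
  | zero => simp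
  | add a b ha hb => simp only [map_add, ha, hb]
  | tmul a b =>
    simp only [map_tmul, takeuchiAct_tmul]
    rw [← LinearMap.comp_apply, ← TensorProduct.map_comp]
    congr 2 <;> · ext; simp [mul_smul]

/-- `M ⊗[R] N` as a left `H`-module: `h • (m ⊗ n) = ∑ h₍₁₎ m ⊗ h₍₂₎ n`. -/
abbrev tensorModule : Module H (M ⊗[R] N) where
  smul h z := takeuchiAct (bd.comulT h) z
  one_smul z := by
    change takeuchiAct (bd.comulT 1) z = z
    induction z with
    | zero => simp
    | add a b ha hb => rw [map_add, ha, hb]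
    | tmul a b => simp [comulT, bd.comul_one]
  mul_smul g h z := by
    change takeuchiAct (bd.comulT (g * h)) z =
      takeuchiAct (bd.comulT g) (takeuchiAct (bd.comulT h) z)
    induction z with
    | zero => simp
    | add a b ha hb => simp only [map_add, ha, hb]
    | tmul a b =>
      simp only [takeuchiAct_tmul]
      rw [act_act]
      simp only [comulT, bd.comul_mul]
  smul_zero h := map_zero _
  smul_add h := map_add _
  add_smul g h z := by
    change takeuchiAct (bd.comulT (g + h)) z =
      takeuchiAct (bd.comulT g) z + takeuchiAct (bd.comulT h) z
    induction z with
    | zero => simp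
    | add a b ha hb => simp only [map_add, ha, hb]; abel
    | tmul a b => simp [comulT]
  zero_smul z := by
    change takeuchiAct (bd.comulT 0) z = 0
    induction z with
    | zero => simp
    | add a b ha hb => simp only [map_add, ha, hb, add_zero]
    | tmul a b => simp [comulT]

/-- `R` as a left `H`-module: `h • r = ε (h r)`. -/
abbrev unitModule : Module H R where
  smul h r := bd.counit (h * (r • (1 : H)))
  one_smul r := by
    change bd.counit (1 * (r • (1 : H))) = r
    simpa using bd.counit_smul_one 1 r
  mul_smul g h r := bd.counit_mul g h r
  smul_zero h := by
    change bd.counit (h * ((0 : R) • (1 : H))) = 0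
    simp
  smul_add h r r' := by
    change bd.counit (h * ((r + r') • (1 : H))) =
      bd.counit (h * (r • (1 : H))) + bd.counit (h * (r' • (1 : H)))
    rw [add_smul, mul_add, map_add]
  add_smul g h r := by
    change bd.counit ((g + h) * (r • (1 : H))) =
      bd.counit (g * (r • (1 : H))) + bd.counit (h * (r • (1 : H)))
    rw [add_mul, map_add]
  zero_smul r := by
    change bd.counit (0 * (r • (1 : H))) = 0
    simp

end Unbundled

end Bialgebroid

namespace Bialgebroid

section Category

variable {R H : Type u} [CommRing R] [Ring H] [Module R H] [IsScalarTower R H H]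

/-- The category of left `H`-modules; this copy carries the monoidal structure that comes from the
bialgebroid structure `bd`. -/
def Mod (_bd : Bialgebroid R H) : Type (u + 1) := ModuleCat.{u} H

/-- The underlying `H`-module. -/
def Mod.mod {bd : Bialgebroid R H} (X : bd.Mod) : ModuleCat.{u} H := X

variable (bd : Bialgebroid R H)

instance : Category bd.Mod := inferInstanceAs (Category (ModuleCat.{u} H))

/-- Restriction along `R → H`. -/
def res : bd.Mod ⥤ ModuleCat.{u} R :=
  ModuleCat.restrictScalars (RingHom.smulOneHom : R →+* H)

instance : bd.res.Faithful :=
  inferInstanceAs (ModuleCat.restrictScalars (RingHom.smulOneHom : R →+* H)).Faithful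

instance (X : bd.Mod) : Module H (bd.res.obj X) :=
  inferInstanceAs (Module H X.mod)

instance (X : bd.Mod) : IsScalarTower R H (bd.res.obj X) where
  smul_assoc r h x := by
    change (r • h) • x = (r • (1 : H)) • (h • x)
    rw [← mul_smul, smul_one_mul]

/-- An `R`-linear map between `H`-modules that commutes with `H`, as a morphism. -/
def liftHom {X Y : bd.Mod} (f : bd.res.obj X ⟶ bd.res.obj Y)
    (hf : ∀ (h : H) (x : bd.res.obj X), f (h • x) = h • f x) : X ⟶ Y :=
  ModuleCat.ofHom (X := X.mod) (Y := Y.mod)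
    { toFun := fun x => f x
      map_add' := fun x y => f.hom.map_add x y
      map_smul' := hf }

theorem res_map_liftHom {X Y : bd.Mod} (f : bd.res.obj X ⟶ bd.res.obj Y)
    (hf : ∀ (h : H) (x : bd.res.obj X), f (h • x) = h • f x) :
    bd.res.map (bd.liftHom f hf) = f := rfl

/-- An `R`-linear isomorphism between `H`-modules that commutes with `H`, as an isomorphism. -/
def liftIso {X Y : bd.Mod} (e : bd.res.obj X ≅ bd.res.obj Y)
    (he : ∀ (h : H) (x : bd.res.obj X), e.hom (h • x) = h • e.hom x) : X ≅ Y where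
  hom := bd.liftHom e.hom he
  inv := bd.liftHom e.inv (fun h y => by
    have := he h (e.inv y)
    have h2 : ∀ z, e.hom (e.inv z) = z := fun z => by
      rw [← ModuleCat.comp_apply, e.inv_hom_id]; rfl
    have h3 : ∀ z, e.inv (e.hom z) = z := fun z => by
      rw [← ModuleCat.comp_apply, e.hom_inv_id]; rfl
    rw [h2] at this
    rw [← this, h3])
  hom_inv_id := bd.res.map_injective (by
    rw [Functor.map_comp, res_map_liftHom, res_map_liftHom, e.hom_inv_id, CategoryTheory.Functor.map_id])
  inv_hom_id := bd.res.map_injective (by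
    rw [Functor.map_comp, res_map_liftHom, res_map_liftHom, e.inv_hom_id, CategoryTheory.Functor.map_id])

/-- `M ⊗[R] N` with `H` acting through the comultiplication. -/
def tensorObj (X Y : bd.Mod) : bd.Mod :=
  letI := bd.tensorModule (bd.res.obj X) (bd.res.obj Y)
  ModuleCat.of H (bd.res.obj X ⊗[R] bd.res.obj Y)

/-- `R` with `H` acting by `h • r = ε (h r)`. -/
def unitObj : bd.Mod :=
  letI := bd.unitModule
  ModuleCat.of H R

/-- The `R`-action on `M ⊗[R] N` obtained through `H` is the usual one. -/
def tensorResEquiv (X Y : bd.Mod) :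
    (bd.res.obj X ⊗[R] bd.res.obj Y) ≃ₗ[R] bd.res.obj (bd.tensorObj X Y) where
  toFun z := z
  invFun z := z
  left_inv _ := rfl
  right_inv _ := rfl
  map_add' _ _ := rfl
  map_smul' r z := by
    change r • z = takeuchiAct (bd.comulT (r • (1 : H))) z
    induction z with
    | zero => simp
    | add a b ha hb => rw [smul_add, map_add, ha, hb]
    | tmul a b => simp [comulT, bd.comul_one]

/-- The `R`-action on the unit object obtained through `H` is the regular one. -/
def unitResEquiv : R ≃ₗ[R] bd.res.obj bd.unitObj where
  toFun z := z
  invFun z := z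
  left_inv _ := rfl
  right_inv _ := rfl
  map_add' _ _ := rfl
  map_smul' r z := by
    change r * z = bd.counit ((r • (1 : H)) * (z • (1 : H)))
    rw [bd.counit_smul_one]

def tensorResIso (X Y : bd.Mod) :
    bd.res.obj X ⊗ bd.res.obj Y ≅ bd.res.obj (bd.tensorObj X Y) :=
  (bd.tensorResEquiv X Y).toModuleIso

def unitResIso : 𝟙_ (ModuleCat.{u} R) ≅ bd.res.obj bd.unitObj :=
  bd.unitResEquiv.toModuleIso

theorem smul_tensorResIso (X Y : bd.Mod) (h : H) (x : bd.res.obj X) (y : bd.res.obj Y) :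
    h • (bd.tensorResIso X Y).hom (x ⊗ₜ[R] y) =
      (bd.tensorResIso X Y).hom
        (TensorProduct.map (orbitMap R H x) (orbitMap R H y) (bd.comul h)) := rfl

theorem tensor_equivariant {X Y Z : bd.Mod} (f : bd.res.obj (bd.tensorObj X Y) ⟶ bd.res.obj Z)
    (hf : ∀ (h : H) (x : bd.res.obj X) (y : bd.res.obj Y),
      f (h • (bd.tensorResIso X Y).hom (x ⊗ₜ[R] y)) =
        h • f ((bd.tensorResIso X Y).hom (x ⊗ₜ[R] y)))
    (h : H) (z : bd.res.obj (bd.tensorObj X Y)) : f (h • z) = h • f z := by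
  have key : ∀ w : bd.res.obj X ⊗[R] bd.res.obj Y,
      f (h • (bd.tensorResIso X Y).hom w) = h • f ((bd.tensorResIso X Y).hom w) := by
    intro w
    induction w with
    | zero =>
      have h0 : (bd.tensorResIso X Y).hom (0 : bd.res.obj X ⊗[R] bd.res.obj Y) = 0 :=
        map_zero (bd.tensorResIso X Y).hom.hom
      rw [h0, smul_zero, map_zero, smul_zero]
    | add a b ha hb =>
      have h0 : (bd.tensorResIso X Y).hom (a + b) =
        (bd.tensorResIso X Y).hom a + (bd.tensorResIso X Y).hom b :=
        map_add (bd.tensorResIso X Y).hom.hom a b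
      rw [h0, smul_add, map_add, map_add, ha, hb, smul_add]
    | tmul a b => exact hf h a b
  exact key z

end Category

end Bialgebroid

namespace Bialgebroid

section Monoidal

variable {R H : Type u} [CommRing R] [Ring H] [Module R H] [IsScalarTower R H H]
variable (bd : Bialgebroid R H)

theorem map_equivariant {X Y : bd.Mod} (f : X ⟶ Y) (h : H) (x : bd.res.obj X) :
    bd.res.map f (h • x) = h • bd.res.map f x :=
  (show X.mod ⟶ Y.mod from f).hom.map_smul h x

theorem tensorHom_equivariant {X Y X' Y' : bd.Mod} (f : bd.res.obj X ⟶ bd.res.obj X')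
    (g : bd.res.obj Y ⟶ bd.res.obj Y')
    (hf : ∀ (h : H) (x : bd.res.obj X), f (h • x) = h • f x)
    (hg : ∀ (h : H) (y : bd.res.obj Y), g (h • y) = h • g y) :
    ∀ (h : H) (z : bd.res.obj (bd.tensorObj X Y)),
      ((bd.tensorResIso X Y).inv ≫ (f ⊗ₘ g) ≫ (bd.tensorResIso X' Y').hom) (h • z) =
        h • ((bd.tensorResIso X Y).inv ≫ (f ⊗ₘ g) ≫ (bd.tensorResIso X' Y').hom) z :=
  bd.tensor_equivariant _ (fun h x y => by
    change TensorProduct.map f.hom g.hom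
        (TensorProduct.map (orbitMap R H x) (orbitMap R H y) (bd.comul h)) =
      TensorProduct.map (orbitMap R H (f x)) (orbitMap R H (g y)) (bd.comul h)
    rw [← LinearMap.comp_apply, ← TensorProduct.map_comp]
    congr 2
    · ext a; exact hf a x
    · ext a; exact hg a y)

theorem orbitMap_tmul (X Y : bd.Mod) (x : bd.res.obj X) (y : bd.res.obj Y) :
    orbitMap R H ((bd.tensorResIso X Y).hom (x ⊗ₜ[R] y)) =
      (bd.tensorResEquiv X Y).toLinearMap ∘ₗ
        TensorProduct.map (orbitMap R H x) (orbitMap R H y) ∘ₗ bd.comul := rfl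

theorem associator_hom_eq (X Y Z : bd.Mod) :
    (((bd.tensorResIso _ _).symm ≪≫ ((bd.tensorResIso _ _).symm ⊗ᵢ .refl _))
        ≪≫ α_ (bd.res.obj X) (bd.res.obj Y) (bd.res.obj Z)
        ≪≫ ((.refl _ ⊗ᵢ bd.tensorResIso _ _) ≪≫ bd.tensorResIso _ _)).hom.hom =
      (bd.tensorResEquiv X (bd.tensorObj Y Z)).toLinearMap ∘ₗ
        TensorProduct.map LinearMap.id (bd.tensorResEquiv Y Z).toLinearMap ∘ₗ
        (TensorProduct.assoc R (bd.res.obj X) (bd.res.obj Y) (bd.res.obj Z)).toLinearMap ∘ₗ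
        TensorProduct.map (bd.tensorResEquiv X Y).symm.toLinearMap LinearMap.id ∘ₗ
        (bd.tensorResEquiv (bd.tensorObj X Y) Z).symm.toLinearMap := rfl

theorem smul_tensorResEquiv (X Y : bd.Mod) (h : H) (x : bd.res.obj X) (y : bd.res.obj Y) :
    h • bd.tensorResEquiv X Y (x ⊗ₜ[R] y) =
      bd.tensorResEquiv X Y
        (TensorProduct.map (orbitMap R H x) (orbitMap R H y) (bd.comul h)) := rfl

theorem associator_equivariant (X Y Z : bd.Mod) :
    ∀ (h : H) (w : bd.res.obj (bd.tensorObj (bd.tensorObj X Y) Z)),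
      (((bd.tensorResIso _ _).symm ≪≫ ((bd.tensorResIso _ _).symm ⊗ᵢ .refl _))
        ≪≫ α_ (bd.res.obj X) (bd.res.obj Y) (bd.res.obj Z)
        ≪≫ ((.refl _ ⊗ᵢ bd.tensorResIso _ _) ≪≫ bd.tensorResIso _ _)).hom (h • w) =
      h • (((bd.tensorResIso _ _).symm ≪≫ ((bd.tensorResIso _ _).symm ⊗ᵢ .refl _))
        ≪≫ α_ (bd.res.obj X) (bd.res.obj Y) (bd.res.obj Z)
        ≪≫ ((.refl _ ⊗ᵢ bd.tensorResIso _ _) ≪≫ bd.tensorResIso _ _)).hom w :=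
  bd.tensor_equivariant _ (fun h v z => by
    obtain ⟨v, rfl⟩ := (bd.tensorResEquiv X Y).surjective v
    induction v with
    | zero => simp only [map_zero, TensorProduct.zero_tmul, smul_zero]
    | add a b ha hb =>
      simp only [map_add, TensorProduct.add_tmul, smul_add] at ha hb ⊢
      rw [ha, hb]
    | tmul x y =>
      have key : TensorProduct.assoc R _ _ _
          (TensorProduct.map (TensorProduct.map (orbitMap R H x) (orbitMap R H y) ∘ₗ bd.comul)
            (orbitMap R H z) (bd.comul h)) =
          TensorProduct.map (orbitMap R H x)
            (TensorProduct.map (orbitMap R H y) (orbitMap R H z) ∘ₗ bd.comul) (bd.comul h) := by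
        have h1 := bd.coassoc_apply h
        have h2 := congrArg (TensorProduct.map (orbitMap R H x)
          (TensorProduct.map (orbitMap R H y) (orbitMap R H z))) h1
        rw [LinearMap.map_lTensor] at h2
        rw [← h2, TensorProduct.map_map_assoc, LinearMap.map_rTensor]
      have e1 : (bd.tensorResEquiv X Y).symm.toLinearMap ∘ₗ
          orbitMap R H ((bd.tensorResEquiv X Y) (x ⊗ₜ[R] y)) =
          TensorProduct.map (orbitMap R H x) (orbitMap R H y) ∘ₗ bd.comul := rfl
      have e2 : (bd.tensorResEquiv Y Z).toLinearMap ∘ₗ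
          TensorProduct.map (orbitMap R H y) (orbitMap R H z) ∘ₗ bd.comul =
          orbitMap R H ((bd.tensorResEquiv Y Z) (y ⊗ₜ[R] z)) := rfl
      have e3 : ∀ w, (bd.tensorResIso (bd.tensorObj X Y) Z).hom w =
        bd.tensorResEquiv (bd.tensorObj X Y) Z w := fun _ => rfl
      rw [e3, smul_tensorResEquiv]
      change ModuleCat.Hom.hom _ _ = h • ModuleCat.Hom.hom _ _
      rw [associator_hom_eq]
      simp only [LinearMap.comp_apply, LinearEquiv.coe_coe, LinearEquiv.symm_apply_apply,
        TensorProduct.map_tmul, TensorProduct.assoc_tmul, LinearMap.id_apply]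
      rw [smul_tensorResEquiv, ← LinearMap.comp_apply
        (TensorProduct.map (bd.tensorResEquiv X Y).symm.toLinearMap _),
        ← TensorProduct.map_comp, e1, LinearMap.id_comp, key, ← LinearMap.comp_apply,
        ← TensorProduct.map_comp, LinearMap.id_comp, e2])

theorem leftUnitor_equivariant (X : bd.Mod) :
    ∀ (h : H) (w : bd.res.obj (bd.tensorObj bd.unitObj X)),
      (((bd.tensorResIso _ _).symm ≪≫ (bd.unitResIso.symm ⊗ᵢ .refl _))
        ≪≫ λ_ (bd.res.obj X)).hom (h • w) =
      h • (((bd.tensorResIso _ _).symm ≪≫ (bd.unitResIso.symm ⊗ᵢ .refl _))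
        ≪≫ λ_ (bd.res.obj X)).hom w :=
  bd.tensor_equivariant _ (fun h r x => by
    obtain ⟨r, rfl⟩ := bd.unitResEquiv.surjective r
    have e1 : bd.unitResEquiv.symm.toLinearMap ∘ₗ orbitMap R H (bd.unitResEquiv r) =
        bd.counit ∘ₗ LinearMap.mulRight R (r • (1 : H)) := rfl
    change TensorProduct.lid R _ (TensorProduct.map bd.unitResEquiv.symm.toLinearMap LinearMap.id
      (TensorProduct.map (orbitMap R H (bd.unitResEquiv r)) (orbitMap R H x) (bd.comul h))) =
      h • (r • x)
    rw [← LinearMap.comp_apply (TensorProduct.map bd.unitResEquiv.symm.toLinearMap _),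
      ← TensorProduct.map_comp, e1, LinearMap.id_comp]
    have h1 := bd.comul_mem h r
    have h2 := congrArg (TensorProduct.map bd.counit (orbitMap R H x)) h1
    rw [LinearMap.map_rTensor, LinearMap.map_lTensor, ← orbitMap_smul] at h2
    rw [h2]
    have h3 : TensorProduct.map bd.counit (orbitMap R H (r • x)) =
        (orbitMap R H (r • x)).lTensor R ∘ₗ bd.counit.rTensor H := by
      rw [LinearMap.lTensor_comp_rTensor]
    rw [h3, LinearMap.comp_apply, bd.rTensor_counit_comul]
    simp)

theorem rightUnitor_equivariant (X : bd.Mod) :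
    ∀ (h : H) (w : bd.res.obj (bd.tensorObj X bd.unitObj)),
      (((bd.tensorResIso _ _).symm ≪≫ (.refl _ ⊗ᵢ bd.unitResIso.symm))
        ≪≫ ρ_ (bd.res.obj X)).hom (h • w) =
      h • (((bd.tensorResIso _ _).symm ≪≫ (.refl _ ⊗ᵢ bd.unitResIso.symm))
        ≪≫ ρ_ (bd.res.obj X)).hom w :=
  bd.tensor_equivariant _ (fun h x r => by
    obtain ⟨r, rfl⟩ := bd.unitResEquiv.surjective r
    have e1 : bd.unitResEquiv.symm.toLinearMap ∘ₗ orbitMap R H (bd.unitResEquiv r) =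
        bd.counit ∘ₗ LinearMap.mulRight R (r • (1 : H)) := rfl
    change TensorProduct.rid R _ (TensorProduct.map LinearMap.id bd.unitResEquiv.symm.toLinearMap
      (TensorProduct.map (orbitMap R H x) (orbitMap R H (bd.unitResEquiv r)) (bd.comul h))) =
      h • (r • x)
    rw [← LinearMap.comp_apply (TensorProduct.map _ bd.unitResEquiv.symm.toLinearMap),
      ← TensorProduct.map_comp, e1, LinearMap.id_comp]
    have h1 := bd.comul_mem h r
    have h2 := congrArg (TensorProduct.map (orbitMap R H x) bd.counit) h1
    rw [LinearMap.map_rTensor, LinearMap.map_lTensor, ← orbitMap_smul] at h2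
    rw [← h2]
    have h3 : TensorProduct.map (orbitMap R H (r • x)) bd.counit =
        (orbitMap R H (r • x)).rTensor R ∘ₗ bd.counit.lTensor H := by
      rw [LinearMap.rTensor_comp_lTensor]
    rw [h3, LinearMap.comp_apply, bd.lTensor_counit_comul]
    simp)

theorem braiding_equivariant [bd.IsCocomm] (X Y : bd.Mod) :
    ∀ (h : H) (w : bd.res.obj (bd.tensorObj X Y)),
      ((bd.tensorResIso _ _).symm ≪≫ β_ (bd.res.obj X) (bd.res.obj Y) ≪≫
        bd.tensorResIso _ _).hom (h • w) =
      h • ((bd.tensorResIso _ _).symm ≪≫ β_ (bd.res.obj X) (bd.res.obj Y) ≪≫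
        bd.tensorResIso _ _).hom w :=
  bd.tensor_equivariant _ (fun h x y => by
    change TensorProduct.comm R _ _
        (TensorProduct.map (orbitMap R H x) (orbitMap R H y) (bd.comul h)) =
      TensorProduct.map (orbitMap R H y) (orbitMap R H x) (bd.comul h)
    rw [← TensorProduct.map_comm, IsCocomm.comm_comul])

/-- Tensor product `M ⊗[R] N`, unit `R`; the structure morphisms are those of `R`-modules. -/
instance : MonoidalCategoryStruct bd.Mod where
  tensorObj := bd.tensorObj
  tensorUnit := bd.unitObj
  tensorHom f g := bd.liftHom _
    (bd.tensorHom_equivariant (bd.res.map f) (bd.res.map g)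
      (bd.map_equivariant f) (bd.map_equivariant g))
  whiskerLeft X _ _ g := bd.liftHom _
    (bd.tensorHom_equivariant (𝟙 (bd.res.obj X)) (bd.res.map g)
      (fun _ _ => rfl) (bd.map_equivariant g))
  whiskerRight f Y := bd.liftHom _
    (bd.tensorHom_equivariant (bd.res.map f) (𝟙 (bd.res.obj Y))
      (bd.map_equivariant f) (fun _ _ => rfl))
  associator X Y Z := bd.liftIso _ (bd.associator_equivariant X Y Z)
  leftUnitor X := bd.liftIso _ (bd.leftUnitor_equivariant X)
  rightUnitor X := bd.liftIso _ (bd.rightUnitor_equivariant X)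

def inducingData : Monoidal.InducingFunctorData bd.res where
  μIso := bd.tensorResIso
  εIso := bd.unitResIso
  whiskerLeft_eq X _ _ f := by rw [← id_tensorHom]; rfl
  whiskerRight_eq f Y := by rw [← tensorHom_id]; rfl
  tensorHom_eq _ _ := rfl
  associator_eq _ _ _ := rfl
  leftUnitor_eq _ := rfl
  rightUnitor_eq _ := rfl

instance : MonoidalCategory bd.Mod := Monoidal.induced bd.res bd.inducingData

instance : bd.res.Monoidal := Monoidal.fromInducedMonoidal bd.res bd.inducingData

/-- The braiding is the flip `m ⊗ n ↦ n ⊗ m`. -/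
instance [bd.IsCocomm] : BraidedCategory bd.Mod :=
  .ofFaithful bd.res (fun X Y => bd.liftIso _ (bd.braiding_equivariant X Y)) (fun X Y => by
    change (bd.tensorResIso X Y).hom ≫ (bd.tensorResIso X Y).inv ≫
      (β_ (bd.res.obj X) (bd.res.obj Y)).hom ≫ (bd.tensorResIso Y X).hom =
      (β_ (bd.res.obj X) (bd.res.obj Y)).hom ≫ (bd.tensorResIso Y X).hom
    rw [Iso.hom_inv_id_assoc])

instance [bd.IsCocomm] : bd.res.Braided where
  braided X Y := by
    change (bd.tensorResIso X Y).hom ≫ (bd.tensorResIso X Y).inv ≫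
      (β_ (bd.res.obj X) (bd.res.obj Y)).hom ≫ (bd.tensorResIso Y X).hom =
      (β_ (bd.res.obj X) (bd.res.obj Y)).hom ≫ (bd.tensorResIso Y X).hom
    rw [Iso.hom_inv_id_assoc]

instance [bd.IsCocomm] : SymmetricCategory bd.Mod := .ofFaithful bd.res

end Monoidal

end Bialgebroid

section Coxeter

variable {B : Type u} (M : CoxeterMatrix B)

/-- `(αₛ, αₜ) = -cos (π / mₛₜ)`; for `mₛₜ = ∞`, which `CoxeterMatrix` encodes as `0`, this is `-1`. -/
def rootForm : (B →₀ ℝ) →ₗ[ℝ] (B →₀ ℝ) →ₗ[ℝ] ℝ :=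
  Finsupp.linearCombination ℝ fun s =>
    Finsupp.linearCombination ℝ fun t => -Real.cos (Real.pi / M s t)

/-- The simple root `αₛ`. -/
def simpleRoot (s : B) : B →₀ ℝ := Finsupp.single s 1

/-- `⟨lam, αₛ^∨⟩ = 2 (lam, αₛ) / (αₛ, αₛ)`, as a linear form in `lam`. -/
def coroot (s : B) : (B →₀ ℝ) →ₗ[ℝ] ℝ :=
  (2 / rootForm M (simpleRoot s) (simpleRoot s)) • (rootForm M).flip (simpleRoot s)

/-- `s(lam) = lam - ⟨lam, αₛ^∨⟩ αₛ`. -/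
def simpleReflection (s : B) : Module.End ℝ (B →₀ ℝ) :=
  Module.preReflection (simpleRoot s) (coroot M s)

theorem coroot_simpleRoot (s t : B) :
    coroot M s (simpleRoot t) = -2 * Real.cos (Real.pi / M s t) := by
  simp [coroot, rootForm, simpleRoot, M.symmetric t s]

theorem coroot_simpleRoot_self (s : B) : coroot M s (simpleRoot s) = 2 := by
  simp [coroot_simpleRoot]

theorem simpleReflection_eq (s : B) :
    simpleReflection M s = (Module.reflection (coroot_simpleRoot_self M s)).toLinearMap := rfl

open Polynomial.Chebyshev in
theorem simpleReflection_isLiftable : M.IsLiftable (simpleReflection M) := by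
  intro s t
  have hmul : (simpleReflection M s * simpleReflection M t) ^ M s t =
      (((Module.reflection (coroot_simpleRoot_self M s)) *
        (Module.reflection (coroot_simpleRoot_self M t))) ^ M s t).toLinearMap := by
    rw [simpleReflection_eq, simpleReflection_eq]
    generalize M s t = n
    induction n with
    | zero => rfl
    | succ n ih => rw [pow_succ, pow_succ, ih]; rfl
  rw [hmul]
  have hc1 := coroot_simpleRoot M s t
  have hc2 := coroot_simpleRoot M t s
  rw [M.symmetric t s] at hc2
  refine LinearMap.ext fun z => ?_
  change ((Module.reflection (coroot_simpleRoot_self M s) *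
    Module.reflection (coroot_simpleRoot_self M t)) ^ M s t) z = z
  rcases eq_or_ne s t with rfl | hst
  · rw [M.diagonal, pow_one]
    exact Module.involutive_reflection (coroot_simpleRoot_self M s) z
  have hm1 : M s t ≠ 1 := M.off_diagonal s t hst
  generalize M s t = m at hc1 hc2 hm1
  rcases Nat.lt_or_ge m 3 with hlt | hge
  · interval_cases m
    · rfl
    · exact absurd rfl hm1
    · have h1 : coroot M s (simpleRoot t) = 0 := by rw [hc1]; simp
      have h2 : coroot M t (simpleRoot s) = 0 := by rw [hc2]; simp
      have h3 := coroot_simpleRoot_self M s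
      have h4 := coroot_simpleRoot_self M t
      simp only [pow_two, LinearEquiv.mul_apply, Module.reflection_apply, map_sub, map_smul,
        h1, h2, h3, h4]
      module
  have hmpos : (0 : ℝ) < m := by exact_mod_cast (by omega : 0 < m)
  have hge' : (3 : ℝ) ≤ m := by exact_mod_cast hge
  set θ : ℝ := 2 * Real.pi / m with hθ
  have hmθ : m * θ = 2 * Real.pi := by rw [hθ]; field_simp
  have hsin : Real.sin θ ≠ 0 := by
    refine (Real.sin_pos_of_pos_of_lt_pi (by positivity) ?_).ne'
    nlinarith [Real.pi_pos]
  have ht : 2 * Real.cos θ =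
      coroot M s (simpleRoot t) * coroot M t (simpleRoot s) - 2 := by
    have : θ = 2 * (Real.pi / m) := by rw [hθ]; ring
    rw [hc1, hc2, this, Real.cos_two_mul]; ring
  have hS : ∀ n : ℤ, (S ℝ n).eval (2 * Real.cos θ) = Real.sin ((n + 1) * θ) / Real.sin θ :=
    fun n => eq_div_of_mul_eq hsin (S_two_mul_real_cos θ n)
  rw [Module.reflection_mul_reflection_pow_apply _ _ m z (2 * Real.cos θ) ht]
  obtain ⟨k, hk | hk⟩ := m.even_or_odd'
  · have i1 : ((m : ℤ) - 2) / 2 = k - 1 := by omega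
    have i2 : ((m : ℤ) - 1) / 2 = k - 1 := by omega
    have hz : (S ℝ ((k : ℤ) - 1)).eval (2 * Real.cos θ) = 0 := by
      rw [hS]
      have : (((k : ℤ) - 1 : ℤ) + 1 : ℝ) * θ = Real.pi := by
        rw [hk] at hmθ; push_cast at hmθ ⊢; linarith
      rw [this]; simp
    rw [i1, i2, hz]; simp
  · have i1 : ((m : ℤ) - 2) / 2 = k - 1 := by omega
    have i2 : ((m : ℤ) - 1) / 2 = k := by omega
    have i3 : ((m : ℤ) - 3) / 2 = k - 1 := by omega
    have i4 : (m : ℤ) / 2 = k := by omega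
    have hz : (S ℝ (k : ℤ)).eval (2 * Real.cos θ) +
        (S ℝ ((k : ℤ) - 1)).eval (2 * Real.cos θ) = 0 := by
      rw [hS, hS, ← add_div]
      have : (((k : ℤ) - 1 : ℤ) + 1 : ℝ) * θ = 2 * Real.pi - (((k : ℤ) + 1) * θ : ℝ) := by
        rw [hk] at hmθ; push_cast at hmθ ⊢; linarith
      rw [this, Real.sin_two_pi_sub]; simp
    rw [i1, i2, i3, i4, hz]; simp

variable {M} {W : Type v} [Group W] (cs : CoxeterSystem M W)

/-- The geometric representation of `W` on `𝔥* = ⊕ₛ ℝ αₛ`. -/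
def geomRep : Representation ℝ W (B →₀ ℝ) :=
  cs.lift ⟨simpleReflection M, simpleReflection_isLiftable M⟩

theorem geomRep_simple (s : B) : geomRep cs (cs.simple s) = simpleReflection M s :=
  cs.lift_apply_simple _ s

variable (B) in
/-- `R = Sym(𝔥*)`. -/
abbrev SymR : Type u := SymmetricAlgebra ℝ (B →₀ ℝ)

/-- The action of `W` on `R` by algebra endomorphisms induced from the geometric representation. -/
def symAction : W →* (SymR B →ₐ[ℝ] SymR B) where
  toFun w := SymmetricAlgebra.lift (SymmetricAlgebra.ι ℝ (B →₀ ℝ) ∘ₗ geomRep cs w)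
  map_one' := by
    rw [map_one]
    exact SymmetricAlgebra.lift_ι
  map_mul' w w' := by
    apply SymmetricAlgebra.algHom_ext
    refine LinearMap.ext fun x => ?_
    simp [AlgHom.mul_apply, Module.End.mul_apply]

/-- `R^W`. -/
def invariants : Subalgebra ℝ (SymR B) where
  carrier := {f | ∀ w : W, symAction cs w f = f}
  mul_mem' ha hb w := by rw [map_mul, ha w, hb w]
  add_mem' ha hb w := by rw [map_add, ha w, hb w]
  algebraMap_mem' r w := AlgHom.commutes _ r

section NilHecke

/-- `a b a ⋯` with `n` factors. -/
def altProd {A : Type*} [Monoid A] (a b : A) : ℕ → A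
  | 0 => 1
  | n + 1 => a * altProd b a n

variable (M)

/-- The defining relations of the nil Hecke algebra. The generators are the weights in `𝔥*`
(`Sum.inl`; the first two relations make them depend linearly on the weight) and the `∂ₛ`
(`Sum.inr`). For `mₛₜ = ∞`, encoded as `0`, the braid relation is `1 = 1`. -/
inductive NilHeckeRel :
    FreeAlgebra ℝ ((B →₀ ℝ) ⊕ B) → FreeAlgebra ℝ ((B →₀ ℝ) ⊕ B) → Prop
  | add (l m : B →₀ ℝ) : NilHeckeRel (.ι ℝ (.inl (l + m))) (.ι ℝ (.inl l) + .ι ℝ (.inl m))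
  | smul (c : ℝ) (l : B →₀ ℝ) : NilHeckeRel (.ι ℝ (.inl (c • l))) (c • .ι ℝ (.inl l))
  | comm (l m : B →₀ ℝ) :
      NilHeckeRel (.ι ℝ (.inl l) * .ι ℝ (.inl m)) (.ι ℝ (.inl m) * .ι ℝ (.inl l))
  | weyl (s : B) (l : B →₀ ℝ) :
      NilHeckeRel (.ι ℝ (.inr s) * .ι ℝ (.inl l))
        (.ι ℝ (.inl (simpleReflection M s l)) * .ι ℝ (.inr s) + algebraMap ℝ _ (coroot M s l))
  | sq (s : B) : NilHeckeRel (.ι ℝ (.inr s) * .ι ℝ (.inr s)) 0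
  | braid (s t : B) :
      NilHeckeRel (altProd (.ι ℝ (.inr s)) (.ι ℝ (.inr t)) (M s t))
        (altProd (.ι ℝ (.inr t)) (.ι ℝ (.inr s)) (M s t))

/-- The nil Hecke algebra. -/
def NilHecke : Type u := RingQuot (NilHeckeRel M)

instance : Ring (NilHecke M) := inferInstanceAs (Ring (RingQuot (NilHeckeRel M)))
instance : Algebra ℝ (NilHecke M) := inferInstanceAs (Algebra ℝ (RingQuot (NilHeckeRel M)))

namespace NilHecke

/-- The quotient map from the free algebra. -/
def mk : FreeAlgebra ℝ ((B →₀ ℝ) ⊕ B) →ₐ[ℝ] NilHecke M := RingQuot.mkAlgHom ℝ (NilHeckeRel M)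

theorem mk_rel {x y : FreeAlgebra ℝ ((B →₀ ℝ) ⊕ B)} (h : NilHeckeRel M x y) :
    mk M x = mk M y :=
  RingQuot.mkAlgHom_rel ℝ h

/-- The weights `𝔥* → nh`. -/
def weight : (B →₀ ℝ) →ₗ[ℝ] NilHecke M where
  toFun l := mk M (.ι ℝ (.inl l))
  map_add' l m := by rw [← map_add, mk_rel M (.add l m)]
  map_smul' c l := by rw [RingHom.id_apply, ← map_smul, mk_rel M (.smul c l)]

/-- The nil Coxeter generator `∂ₛ`. -/
def del (s : B) : NilHecke M := mk M (.ι ℝ (.inr s))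

theorem weight_comm (l m : B →₀ ℝ) : weight M l * weight M m = weight M m * weight M l := by
  change mk M _ * mk M _ = mk M _ * mk M _
  rw [← map_mul, ← map_mul, mk_rel M (.comm l m)]

theorem weight_comm_range : ∀ a ∈ Set.range (weight M), ∀ b ∈ Set.range (weight M),
    a * b = b * a := by
  rintro _ ⟨l, rfl⟩ _ ⟨m, rfl⟩
  exact weight_comm M l m

/-- The algebra map `R → nh` extending `𝔥* → nh`. -/
def ofSym : SymR B →ₐ[ℝ] NilHecke M :=
  letI : CommRing (Algebra.adjoin ℝ (Set.range (weight M))) :=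
    { (Algebra.adjoin ℝ (Set.range (weight M))).toRing with
      mul_comm := (Algebra.isMulCommutative_adjoin ℝ (weight_comm_range M)).is_comm.comm }
  (Algebra.adjoin ℝ (Set.range (weight M))).val.comp
    (SymmetricAlgebra.lift ((weight M).codRestrict
      (Subalgebra.toSubmodule (Algebra.adjoin ℝ (Set.range (weight M))))
      (fun l => Algebra.subset_adjoin ⟨l, rfl⟩)))

theorem ofSym_ι (l : B →₀ ℝ) : ofSym M (SymmetricAlgebra.ι ℝ _ l) = weight M l := by
  simp [ofSym]
  rfl

instance : Module (SymR B) (NilHecke M) := Module.compHom _ (ofSym M).toRingHom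

theorem smul_def (f : SymR B) (h : NilHecke M) : f • h = ofSym M f * h := rfl

instance : IsScalarTower (SymR B) (NilHecke M) (NilHecke M) where
  smul_assoc f g h := mul_assoc (ofSym M f) g h

/-- The simple reflection `s = 1 - αₛ ∂ₛ` in `nh`. -/
def reflElt (s : B) : NilHecke M := 1 - weight M (simpleRoot s) * del M s

end NilHecke

end NilHecke

end Coxeter

section Functor

variable {R' P H : Type u} [CommRing R'] [AddCommGroup P] [Module R' P] [Ring H]

/-- `h ↦ ρ h ⊗ id` on `P ⊗[R'] N`. -/
def tensorRep (ρ : H →+* Module.End R' P) (N : Type u) [AddCommGroup N] [Module R' N] :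
    H →+* Module.End R' (P ⊗[R'] N) :=
  (Module.End.rTensorAlgHom R' P N).toRingHom.comp ρ

/-- The functor `N ↦ P ⊗[R'] N`, with `H` acting by `h • (p ⊗ n) = ρ h p ⊗ n`. -/
def repTensor (ρ : H →+* Module.End R' P) : ModuleCat.{u} R' ⥤ ModuleCat.{u} H where
  obj N :=
    letI := Module.compHom (P ⊗[R'] N) (tensorRep ρ N)
    ModuleCat.of H (P ⊗[R'] N)
  map {N N'} f :=
    letI := Module.compHom (P ⊗[R'] N) (tensorRep ρ N)
    letI := Module.compHom (P ⊗[R'] N') (tensorRep ρ N')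
    ModuleCat.ofHom (X := P ⊗[R'] N) (Y := P ⊗[R'] N')
      { toFun := f.hom.lTensor P
        map_add' := map_add _
        map_smul' := fun h z => by
          change (f.hom.lTensor P ∘ₗ (ρ h).rTensor N) z = ((ρ h).rTensor N' ∘ₗ f.hom.lTensor P) z
          rw [LinearMap.lTensor_comp_rTensor, LinearMap.rTensor_comp_lTensor] }
  map_id N := by
    refine ConcreteCategory.hom_ext _ _ fun z => ?_
    exact LinearMap.congr_fun (LinearMap.lTensor_id P N) z
  map_comp {N N' N''} f g := by
    refine ConcreteCategory.hom_ext _ _ fun z => ?_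
    exact LinearMap.congr_fun (LinearMap.lTensor_comp P g.hom f.hom) z

/-- The functor `N ↦ P ⊗[R'] N` with values in the monoidal category of the bialgebroid. -/
def Bialgebroid.repTensor {R : Type u} [CommRing R] [Module R H] [IsScalarTower R H H]
    (bd : Bialgebroid R H) (ρ : H →+* Module.End R' P) : ModuleCat.{u} R' ⥤ bd.Mod :=
  _root_.repTensor ρ

end Functor

end

/-!
By Matsumoto's theorem a product of the `∂ₛ` along a word that is not reduced vanishes. Hence every
product of more than `ℓ(w₀)` of the `∂ₛ` is `0`, and the product `d` along a reduced word of the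
longest element `w₀` satisfies `∂ₛ d = 0` for all `s`. Expanding `ρ(d)` in the twisted group ring
of `W` over the fraction field of `R`, one finds `f` in `R` with `ρ(d)(f) = 1`. Since `ρ(d)` takes
values in `R^W`, this makes `R^W` a direct summand of `R`.

Every `h` is congruent to `ρ(h)(1)` modulo the left ideal generated by the `∂ₛ`, so `d f` is
congruent to `1`. By downward induction on the number of factors, the two-sided ideal generated by
`d` contains all products of the `∂ₛ`, the empty one included: `1 = ∑ yᵢ d zᵢ`. As
`h d = ρ(h)(1) d`, every `h` equals `∑ ρ(h)(aᵢ) cᵢ` with `aᵢ = ρ(yᵢ)(1)` and `cᵢ = d zᵢ`. In other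
words, the `aᵢ` and the functionals `ρ(cᵢ) : R → R^W` are a dual basis of the `R^W`-module `R`,
compatibly with `nh`. Therefore `ρ` is bijective, `Δ` exists as the dual of the multiplication of
`R`, and `R` is a progenerator of `R^W`-modules, so that the equivalence is Morita theory.
-/

section DihedralCoefficients

/-- The numbers `sin (k π / m) / sin (π / m)`: they are the coordinates of the roots of the dihedral
group of order `2 m`. Evaluating a Chebyshev polynomial covers the case `m = ∞`, encoded as `m = 0`,
where the value is the limit `k`. -/
noncomputable def dihedralCoeff (m k : ℕ) : ℝ :=
  (Polynomial.Chebyshev.S ℝ ((k : ℤ) - 1)).eval (2 * Real.cos (Real.pi / m))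

@[simp]
theorem dihedralCoeff_zero (m : ℕ) : dihedralCoeff m 0 = 0 := by simp [dihedralCoeff]

@[simp]
theorem dihedralCoeff_one (m : ℕ) : dihedralCoeff m 1 = 1 := by simp [dihedralCoeff]

theorem dihedralCoeff_add_two (m k : ℕ) : dihedralCoeff m (k + 2) =
    2 * Real.cos (Real.pi / m) * dihedralCoeff m (k + 1) - dihedralCoeff m k := by
  have h := Polynomial.Chebyshev.S_add_two ℝ ((k : ℤ) - 1)
  rw [show (k : ℤ) - 1 + 2 = ((k + 2 : ℕ) : ℤ) - 1 by push_cast; ring,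
    show (k : ℤ) - 1 + 1 = ((k + 1 : ℕ) : ℤ) - 1 by push_cast; ring] at h
  rw [dihedralCoeff, h, Polynomial.eval_sub, Polynomial.eval_mul, Polynomial.eval_X]
  rfl

theorem dihedralCoeff_mul_sin (m k : ℕ) :
    dihedralCoeff m k * Real.sin (Real.pi / m) = Real.sin (k * (Real.pi / m)) := by
  rw [dihedralCoeff, Polynomial.Chebyshev.S_two_mul_real_cos]
  push_cast
  rw [sub_add_cancel]

theorem sin_pi_div_pos {m : ℕ} (hm : 2 ≤ m) : 0 < Real.sin (Real.pi / m) := by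
  have hm' : (2 : ℝ) ≤ m := by exact_mod_cast hm
  refine Real.sin_pos_of_pos_of_lt_pi (by positivity) ?_
  exact div_lt_self Real.pi_pos (by linarith)

theorem dihedralCoeff_nonneg {m k : ℕ} (hm1 : m ≠ 1) (hk : m = 0 ∨ k ≤ m) :
    0 ≤ dihedralCoeff m k := by
  rcases Nat.eq_zero_or_pos m with rfl | hm
  · simp [dihedralCoeff]
  refine nonneg_of_mul_nonneg_left ?_ (sin_pi_div_pos (m := m) (by omega))
  rw [dihedralCoeff_mul_sin]
  have hkm : (k : ℝ) ≤ m := by exact_mod_cast (by omega : k ≤ m)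
  refine Real.sin_nonneg_of_nonneg_of_le_pi (by positivity) ?_
  rw [← mul_div_assoc, div_le_iff₀ (by positivity), mul_comm]
  gcongr

theorem dihedralCoeff_self {m : ℕ} (hm : 2 ≤ m) : dihedralCoeff m m = 0 := by
  refine (mul_eq_zero.mp ?_).resolve_right (sin_pi_div_pos hm).ne'
  have : (m : ℝ) ≠ 0 := by positivity
  rw [dihedralCoeff_mul_sin, mul_div_cancel₀ _ this, Real.sin_pi]

theorem dihedralCoeff_pred {m : ℕ} (hm : 2 ≤ m) : dihedralCoeff m (m - 1) = 1 := by
  have : (m : ℝ) ≠ 0 := by positivity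
  refine mul_right_cancel₀ (sin_pi_div_pos hm).ne' ?_
  rw [dihedralCoeff_mul_sin, one_mul, Nat.cast_sub (by omega), sub_mul, mul_div_cancel₀ _ this,
    Nat.cast_one, one_mul, Real.sin_pi_sub]

end DihedralCoefficients

section ReducedSuffix

open CoxeterSystem

variable {B : Type u} {M : CoxeterMatrix B} {W : Type v} [Group W] (cs : CoxeterSystem M W)

theorem exists_braidWord_eq_append {s t : B} (hst : M s t ≠ 0) :
    ∃ ω, braidWord M s t = ω ++ [t] := by
  obtain ⟨m, hm⟩ := Nat.exists_eq_succ_of_ne_zero hst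
  exact ⟨alternatingWord t s m, by rw [braidWord, hm, alternatingWord_succ, List.concat_eq_append]⟩

/-- Some reduced word of `w` ends with the word `ω`. This is encoded by the additivity of lengths in
`w = (w ω⁻¹) ω`; in particular `ω` is reduced. -/
def HasReducedSuffix (w : W) (ω : List B) : Prop :=
  cs.length (w * (cs.wordProd ω)⁻¹) + ω.length = cs.length w

namespace HasReducedSuffix

variable {cs} {w : W} {ω ω' γ : List B} {s t : B}

theorem singleton_iff : HasReducedSuffix cs w [s] ↔ cs.IsRightDescent w s := by
  rw [HasReducedSuffix, wordProd_singleton, inv_simple, isRightDescent_iff, List.length_singleton]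

theorem cons_iff : HasReducedSuffix cs w (s :: ω) ↔
    HasReducedSuffix cs w ω ∧ cs.IsRightDescent (w * (cs.wordProd ω)⁻¹) s := by
  have hw : cs.length w ≤ cs.length (w * (cs.wordProd ω)⁻¹) + ω.length := by
    simpa using (cs.length_mul_le (w * (cs.wordProd ω)⁻¹) (cs.wordProd ω)).trans
      (Nat.add_le_add_left (cs.length_wordProd_le ω) _)
  rw [HasReducedSuffix, HasReducedSuffix, isRightDescent_iff, wordProd_cons, mul_inv_rev,
    inv_simple, ← mul_assoc, List.length_cons]
  have hs := cs.length_mul_simple (w * (cs.wordProd ω)⁻¹) s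
  omega

theorem of_append (h : HasReducedSuffix cs w (ω ++ ω')) : HasReducedSuffix cs w ω' := by
  induction ω with
  | nil => exact h
  | cons s ω ih => exact ih (cons_iff.mp h).1

theorem not_cons_cons_self : ¬ HasReducedSuffix cs w (s :: s :: ω) := by
  rw [cons_iff, cons_iff, wordProd_cons, mul_inv_rev, inv_simple, ← mul_assoc]
  exact fun h => cs.isRightDescent_iff_not_isRightDescent_mul.mp h.1.2 h.2

theorem length_le (h : HasReducedSuffix cs w ω) : ω.length ≤ cs.length w :=
  (Nat.le_add_left _ _).trans h.le

theorem congr (h : HasReducedSuffix cs w ω) (hprod : cs.wordProd ω = cs.wordProd ω')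
    (hlen : ω.length = ω'.length) : HasReducedSuffix cs w ω' := by
  rwa [HasReducedSuffix, ← hprod, ← hlen]

theorem of_isReduced_append (h : cs.IsReduced (γ ++ ω)) :
    HasReducedSuffix cs (cs.wordProd (γ ++ ω)) ω := by
  have h1 := cs.length_wordProd_le γ
  have h2 := cs.length_mul_le (cs.wordProd γ) (cs.wordProd ω)
  have h3 := cs.length_wordProd_le ω
  rw [HasReducedSuffix, h.eq, List.length_append, wordProd_append, mul_inv_cancel_right]
  rw [← wordProd_append, h.eq, List.length_append] at h2
  omega

theorem wordProd_append_eq (hγ : cs.wordProd γ = w * (cs.wordProd ω)⁻¹) :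
    cs.wordProd (γ ++ ω) = w := by
  rw [wordProd_append, hγ, inv_mul_cancel_right]

theorem isReduced_append (h : HasReducedSuffix cs w ω) (hγ : cs.IsReduced γ)
    (hγw : cs.wordProd γ = w * (cs.wordProd ω)⁻¹) : cs.IsReduced (γ ++ ω) := by
  rw [CoxeterSystem.IsReduced, wordProd_append_eq hγw, ← h, ← hγw, hγ.eq, List.length_append]

theorem exists_isReduced_append (h : HasReducedSuffix cs w ω) :
    ∃ γ, cs.IsReduced (γ ++ ω) ∧ cs.wordProd (γ ++ ω) = w := by
  obtain ⟨γ, hγ, hγw⟩ := cs.exists_isReduced (w * (cs.wordProd ω)⁻¹)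
  exact ⟨γ, h.isReduced_append hγ hγw.symm, wordProd_append_eq hγw.symm⟩

theorem alternatingWord_of_le {k l : ℕ} (hkl : k ≤ l)
    (h : HasReducedSuffix cs w (alternatingWord s t l)) :
    HasReducedSuffix cs w (alternatingWord s t k) := by
  induction hkl with
  | refl => exact h
  | step _ ih =>
    rw [alternatingWord_succ'] at h
    exact ih (cons_iff.mp h).1

theorem braidWord_swap (h : HasReducedSuffix cs w (braidWord M s t)) :
    HasReducedSuffix cs w (braidWord M t s) :=
  h.congr (cs.wordProd_braidWord_eq s t) (by simp [M.symmetric])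

theorem exists_isReduced_append_braidWord (h : HasReducedSuffix cs w (braidWord M s t)) :
    ∃ γ, (cs.IsReduced (γ ++ braidWord M s t) ∧ cs.wordProd (γ ++ braidWord M s t) = w) ∧
      cs.IsReduced (γ ++ braidWord M t s) ∧ cs.wordProd (γ ++ braidWord M t s) = w := by
  obtain ⟨γ, hγ, hγt⟩ := cs.exists_isReduced (w * (cs.wordProd (braidWord M s t))⁻¹)
  have hγs := hγt
  rw [wordProd_braidWord_eq] at hγs
  exact ⟨γ, ⟨h.isReduced_append hγ hγt.symm, wordProd_append_eq hγt.symm⟩,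
    h.braidWord_swap.isReduced_append hγ hγs.symm, wordProd_append_eq hγs.symm⟩

theorem isRightDescent_of_braidWord (hst : M s t ≠ 0)
    (h : HasReducedSuffix cs w (braidWord M s t)) : cs.IsRightDescent w t := by
  obtain ⟨ω, hω⟩ := exists_braidWord_eq_append hst
  exact singleton_iff.mp (hω ▸ h).of_append

theorem not_isRightDescent_of_alternatingWord {k : ℕ}
    (h : HasReducedSuffix cs w (alternatingWord s t (k + 1))) :
    ¬ cs.IsRightDescent (w * (cs.wordProd (alternatingWord s t (k + 1)))⁻¹)
      (if Even k then t else s) := by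
  intro hx
  have := cons_iff.mpr ⟨h, hx⟩
  rw [alternatingWord_succ'] at this
  exact not_cons_cons_self this

/-- The decomposition of `w` with respect to the dihedral subgroup generated by `s` and `t`. -/
theorem exists_alternatingWord_not_isRightDescent (s : B) (ht : cs.IsRightDescent w t) :
    ∃ k, 0 < k ∧ HasReducedSuffix cs w (alternatingWord s t k) ∧
      ¬ cs.IsRightDescent (w * (cs.wordProd (alternatingWord s t k))⁻¹) s ∧
      ¬ cs.IsRightDescent (w * (cs.wordProd (alternatingWord s t k))⁻¹) t := by
  classical
  have h1 : HasReducedSuffix cs w (alternatingWord s t 1) := by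
    simpa [alternatingWord] using singleton_iff.mpr ht
  have hbound {k : ℕ} (h : HasReducedSuffix cs w (alternatingWord s t k)) : k ≤ cs.length w := by
    simpa using h.length_le
  let P (k : ℕ) := HasReducedSuffix cs w (alternatingWord s t (k + 1))
  let k := Nat.findGreatest P (cs.length w)
  have hk : P k := Nat.findGreatest_spec (P := P) (Nat.zero_le _) h1
  have hlast := not_isRightDescent_of_alternatingWord hk
  have hnext : ¬ cs.IsRightDescent (w * (cs.wordProd (alternatingWord s t (k + 1)))⁻¹)
      (if Even (k + 1) then t else s) := by
    intro hx
    have hk' : P (k + 1) := by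
      change HasReducedSuffix cs w _
      rw [alternatingWord_succ' s t (k + 1)]
      exact cons_iff.mpr ⟨hk, hx⟩
    have := hbound hk'
    have := Nat.le_findGreatest (P := P) (n := cs.length w) (by omega) hk'
    omega
  refine ⟨k + 1, k.succ_pos, hk, ?_⟩
  by_cases hpar : Even k
  · simp only [hpar, Nat.even_add_one, not_true, if_true, if_false] at hlast hnext
    exact ⟨hnext, hlast⟩
  · simp only [hpar, Nat.even_add_one, not_false_iff, if_true, if_false] at hlast hnext
    exact ⟨hlast, hnext⟩

end HasReducedSuffix

end ReducedSuffix

section Positivity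

variable {B : Type u} {M : CoxeterMatrix B} {W : Type v} [Group W] (cs : CoxeterSystem M W)

open CoxeterSystem

theorem simpleReflection_simpleRoot (s t : B) :
    simpleReflection M s (simpleRoot t) =
      simpleRoot t + (2 * Real.cos (Real.pi / M s t)) • simpleRoot s := by
  simp [simpleReflection, Module.preReflection_apply, coroot_simpleRoot, sub_eq_add_neg]

theorem simpleReflection_simpleRoot_self (s : B) :
    simpleReflection M s (simpleRoot s) = -simpleRoot s := by
  rw [simpleReflection_eq]
  exact Module.reflection_apply_self (coroot_simpleRoot_self M s)

theorem simpleRoot_ne_zero (s : B) : simpleRoot s ≠ 0 :=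
  Finsupp.single_ne_zero.mpr one_ne_zero

theorem simpleRoot_nonneg (s : B) : 0 ≤ simpleRoot s :=
  Finsupp.single_nonneg.mpr zero_le_one

theorem geomRep_alternatingWord_simpleRoot (s t : B) (k : ℕ) :
    geomRep cs (cs.wordProd (alternatingWord s t k)) (simpleRoot s) =
      dihedralCoeff (M s t) (k + 1) • simpleRoot (if Even k then s else t) +
        dihedralCoeff (M s t) k • simpleRoot (if Even k then t else s) := by
  induction k with
  | zero => simp [alternatingWord]
  | succ k ih =>
    rw [alternatingWord_succ', wordProd_cons, map_mul, Module.End.mul_apply, ih, geomRep_simple]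
    by_cases hk : Even k <;>
    · simp only [hk, Nat.even_add_one, not_true, not_false_iff, if_true, if_false, map_add,
        map_smul, simpleReflection_simpleRoot_self, simpleReflection_simpleRoot, M.symmetric t s,
        dihedralCoeff_add_two]
      module

theorem geomRep_simpleRoot_ne_zero (w : W) (s : B) : geomRep cs w (simpleRoot s) ≠ 0 :=
  fun h => simpleRoot_ne_zero s <|
    ((geomRep cs).apply_bijective w).injective (h.trans (map_zero _).symm)

/-- Write `w = v u` with `u` in the dihedral subgroup generated by `s` and `t` and with `v` minimal
in its coset; the coefficients `p` and `q` are those of the root `u αₛ`. -/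
theorem exists_geomRep_simpleRoot_eq {w : W} {s t : B} (hst : s ≠ t) (ht : cs.IsRightDescent w t)
    (h : ¬ (M s t ≠ 0 ∧ HasReducedSuffix cs w (braidWord M s t))) :
    ∃ (v : W) (p q : ℝ), cs.length v < cs.length w ∧
      ¬ cs.IsRightDescent v s ∧ ¬ cs.IsRightDescent v t ∧ 0 ≤ p ∧ 0 ≤ q ∧
      geomRep cs w (simpleRoot s) =
        p • geomRep cs v (simpleRoot s) + q • geomRep cs v (simpleRoot t) := by
  obtain ⟨k, hk, hsuff, hvs, hvt⟩ :=
    HasReducedSuffix.exists_alternatingWord_not_isRightDescent s ht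
  set v := w * (cs.wordProd (alternatingWord s t k))⁻¹ with hv
  have hlen : cs.length v < cs.length w := by
    rw [← hsuff, length_alternatingWord]
    exact Nat.lt_add_of_pos_right hk
  have hkm : M s t = 0 ∨ k + 1 ≤ M s t := by
    by_contra hkm
    exact h ⟨by omega, hsuff.alternatingWord_of_le (by omega)⟩
  have hm1 := M.off_diagonal s t hst
  have hc1 : 0 ≤ dihedralCoeff (M s t) (k + 1) := dihedralCoeff_nonneg hm1 hkm
  have hc2 : 0 ≤ dihedralCoeff (M s t) k := dihedralCoeff_nonneg hm1 (by omega)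
  have hw : geomRep cs w (simpleRoot s) =
      dihedralCoeff (M s t) (k + 1) • geomRep cs v (simpleRoot (if Even k then s else t)) +
        dihedralCoeff (M s t) k • geomRep cs v (simpleRoot (if Even k then t else s)) := by
    rw [← map_smul, ← map_smul, ← map_add, ← geomRep_alternatingWord_simpleRoot cs,
      ← Module.End.mul_apply, ← map_mul, hv, inv_mul_cancel_right]
  by_cases hpar : Even k
  · simp only [hpar, if_true] at hw
    exact ⟨v, _, _, hlen, hvs, hvt, hc1, hc2, hw⟩
  · simp only [hpar, if_false] at hw
    exact ⟨v, _, _, hlen, hvs, hvt, hc2, hc1, by rw [hw, add_comm]⟩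

theorem geomRep_simpleRoot_nonneg {w : W} {s : B} (hs : ¬ cs.IsRightDescent w s) :
    0 ≤ geomRep cs w (simpleRoot s) := by
  induction hn : cs.length w using Nat.strong_induction_on generalizing w s with
  | _ n ih =>
  rcases eq_or_ne w 1 with rfl | hw
  · simpa using simpleRoot_nonneg s
  obtain ⟨t, ht⟩ := cs.exists_rightDescent_of_ne_one hw
  have hst : s ≠ t := by rintro rfl; exact hs ht
  obtain ⟨v, p, q, hl, hvs, hvt, hp, hq, h⟩ := exists_geomRep_simpleRoot_eq cs hst ht
    fun ⟨hm, hsuff⟩ =>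
      hs (hsuff.braidWord_swap.isRightDescent_of_braidWord (M.symmetric s t ▸ hm))
  rw [h]
  have hl' := hn ▸ hl
  exact add_nonneg (smul_nonneg hp (ih _ hl' hvs rfl)) (smul_nonneg hq (ih _ hl' hvt rfl))

theorem geomRep_simpleRoot_nonpos {w : W} {s : B} (hs : cs.IsRightDescent w s) :
    geomRep cs w (simpleRoot s) ≤ 0 := by
  have h := geomRep_simpleRoot_nonneg cs
    (cs.isRightDescent_iff_not_isRightDescent_mul.mp hs)
  rwa [map_mul, Module.End.mul_apply, geomRep_simple, simpleReflection_simpleRoot_self, map_neg,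
    neg_nonneg] at h

theorem not_isRightDescent_iff_geomRep_simpleRoot_nonneg {w : W} {s : B} :
    ¬ cs.IsRightDescent w s ↔ 0 ≤ geomRep cs w (simpleRoot s) :=
  ⟨geomRep_simpleRoot_nonneg cs, fun h hs => geomRep_simpleRoot_ne_zero cs w s
    (le_antisymm (geomRep_simpleRoot_nonpos cs hs) h)⟩

theorem geomRep_injective : Function.Injective (geomRep cs) := by
  refine (injective_iff_map_eq_one _).mpr fun w hw => ?_
  by_contra hne
  obtain ⟨s, hs⟩ := cs.exists_rightDescent_of_ne_one hne
  refine (not_isRightDescent_iff_geomRep_simpleRoot_nonneg cs).mpr ?_ hs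
  simpa [hw] using simpleRoot_nonneg s

theorem hasReducedSuffix_braidWord {w : W} {s t : B} (hst : s ≠ t) (hs : cs.IsRightDescent w s)
    (ht : cs.IsRightDescent w t) :
    M s t ≠ 0 ∧ HasReducedSuffix cs w (braidWord M s t) := by
  by_contra hsuff
  obtain ⟨v, p, q, -, hvs, hvt, hp, hq, h⟩ := exists_geomRep_simpleRoot_eq cs hst ht hsuff
  refine (not_isRightDescent_iff_geomRep_simpleRoot_nonneg cs).mpr ?_ hs
  rw [h]
  exact add_nonneg (smul_nonneg hp (geomRep_simpleRoot_nonneg cs hvs))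
    (smul_nonneg hq (geomRep_simpleRoot_nonneg cs hvt))

end Positivity

section Matsumoto

open CoxeterSystem

variable {B : Type u} {M : CoxeterMatrix B} {W : Type v} [Group W] (cs : CoxeterSystem M W)
variable {A : Type*} {f : B → A}

theorem prod_map_append_singleton_eq [Monoid A] {n : ℕ}
    (hn : ∀ ω ω' : List B, cs.IsReduced ω → cs.IsReduced ω' → cs.wordProd ω = cs.wordProd ω' →
      ω.length = n → (ω.map f).prod = (ω'.map f).prod)
    {ω ω' : List B} {s : B} (hω : cs.IsReduced (ω ++ [s])) (hω' : cs.IsReduced (ω' ++ [s]))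
    (h : cs.wordProd (ω ++ [s]) = cs.wordProd (ω' ++ [s])) (hlen : (ω ++ [s]).length = n + 1) :
    ((ω ++ [s]).map f).prod = ((ω' ++ [s]).map f).prod := by
  have hred : cs.IsReduced ω := by simpa using hω.take ω.length
  have hred' : cs.IsReduced ω' := by simpa using hω'.take ω'.length
  rw [wordProd_append, wordProd_append, mul_left_inj] at h
  rw [List.map_append, List.map_append, List.prod_append, List.prod_append,
    hn ω ω' hred hred' h (by simpa using hlen)]

/-- Matsumoto's theorem. -/
theorem prod_map_eq_of_isReduced [Monoid A]
    (hf : ∀ s t, ((braidWord M s t).map f).prod = ((braidWord M t s).map f).prod)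
    {ω ω' : List B} (hω : cs.IsReduced ω) (hω' : cs.IsReduced ω')
    (h : cs.wordProd ω = cs.wordProd ω') : (ω.map f).prod = (ω'.map f).prod := by
  have hlen : ω'.length = ω.length := by rw [← hω.eq, h, hω'.eq]
  induction hn : ω.length generalizing ω ω' with
  | zero =>
    rw [hn, List.length_eq_zero_iff] at hlen
    rw [List.length_eq_zero_iff.mp hn, hlen]
  | succ n ih =>
    have ih' (ω ω' : List B) (hω : cs.IsReduced ω) (hω' : cs.IsReduced ω')
        (h : cs.wordProd ω = cs.wordProd ω') : ω.length = n → (ω.map f).prod = (ω'.map f).prod :=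
      ih hω hω' h (by rw [← hω.eq, h, hω'.eq])
    rcases List.eq_nil_or_concat' ω with rfl | ⟨α, s, rfl⟩
    · simp at hn
    rcases List.eq_nil_or_concat' ω' with rfl | ⟨β, t, rfl⟩
    · simp at hlen
    rcases eq_or_ne s t with rfl | hst
    · exact prod_map_append_singleton_eq cs ih' hω hω' h hn
    have hs := HasReducedSuffix.singleton_iff.mp (.of_isReduced_append hω)
    have ht := HasReducedSuffix.singleton_iff.mp (.of_isReduced_append hω')
    obtain ⟨hm, hsuff⟩ := hasReducedSuffix_braidWord cs hst hs (h ▸ ht)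
    obtain ⟨γ, ⟨hredt, hγt⟩, hreds, hγs⟩ := hsuff.exists_isReduced_append_braidWord
    obtain ⟨δ, hδ⟩ := exists_braidWord_eq_append hm
    obtain ⟨ε, hε⟩ := exists_braidWord_eq_append (M.symmetric s t ▸ hm)
    have hα : ((α ++ [s]).map f).prod = ((γ ++ braidWord M t s).map f).prod := by
      rw [hε, ← List.append_assoc] at hreds hγs ⊢
      exact prod_map_append_singleton_eq cs ih' hω hreds hγs.symm hn
    have hβ : ((β ++ [t]).map f).prod = ((γ ++ braidWord M s t).map f).prod := by
      rw [hδ, ← List.append_assoc] at hredt hγt ⊢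
      exact prod_map_append_singleton_eq cs ih' hω' hredt (h.symm.trans hγt.symm) (hlen.trans hn)
    rw [hα, hβ, List.map_append, List.map_append, List.prod_append, List.prod_append, hf]

theorem prod_map_eq_zero_of_not_isReduced [MonoidWithZero A]
    (hf : ∀ s t, ((braidWord M s t).map f).prod = ((braidWord M t s).map f).prod)
    (hsq : ∀ s, f s * f s = 0) {ω : List B} (hω : ¬ cs.IsReduced ω) :
    (ω.map f).prod = 0 := by
  induction ω using List.reverseRecOn with
  | nil => exact absurd (by simp [CoxeterSystem.IsReduced]) hω
  | append_singleton ω s ih =>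
    rw [List.map_append, List.prod_append]
    by_cases h : cs.IsReduced ω
    swap
    · rw [ih h, zero_mul]
    have hs : cs.IsRightDescent (cs.wordProd ω) s := by
      by_contra hs
      rw [not_isRightDescent_iff, h.eq] at hs
      refine hω ?_
      rw [CoxeterSystem.IsReduced, wordProd_append, wordProd_singleton, hs, List.length_append,
        List.length_singleton]
    obtain ⟨γ, hγ, hγω⟩ := (HasReducedSuffix.singleton_iff.mpr hs).exists_isReduced_append
    rw [prod_map_eq_of_isReduced cs hf h hγ hγω.symm]
    simp [mul_assoc, hsq]

end Matsumoto

section AlternatingProducts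

variable {A : Type*} [Monoid A]

theorem altProd_succ_right (a b : A) (n : ℕ) :
    altProd a b (n + 1) = altProd a b n * (if Even n then a else b) := by
  induction n generalizing a b with
  | zero => simp [altProd]
  | succ n ih =>
    rw [altProd, ih b a, ← mul_assoc]
    by_cases hn : Even n <;>
      simp only [hn, altProd, Nat.even_add_one, not_true, not_false_iff, if_true, if_false]

theorem map_altProd {A' F : Type*} [Monoid A'] [FunLike F A A'] [MonoidHomClass F A A'] (φ : F)
    (a b : A) (n : ℕ) : φ (altProd a b n) = altProd (φ a) (φ b) n := by
  induction n generalizing a b with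
  | zero => simp [altProd]
  | succ n ih => simp [altProd, ih]

theorem prod_map_alternatingWord {B : Type*} (f : B → A) (s t : B) (m : ℕ) :
    ((CoxeterSystem.alternatingWord s t m).map f).prod =
      if Even m then altProd (f s) (f t) m else altProd (f t) (f s) m := by
  induction m with
  | zero => simp [CoxeterSystem.alternatingWord, altProd]
  | succ m ih =>
    rw [CoxeterSystem.alternatingWord_succ', List.map_cons, List.prod_cons, ih]
    by_cases hm : Even m <;>
      simp only [hm, altProd, Nat.even_add_one, not_true, not_false_iff, if_true, if_false]

theorem prod_map_braidWord_eq_iff {B : Type*} (M : CoxeterMatrix B) (f : B → A) (s t : B) :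
    ((CoxeterSystem.braidWord M s t).map f).prod = ((CoxeterSystem.braidWord M t s).map f).prod ↔
      altProd (f s) (f t) (M s t) = altProd (f t) (f s) (M s t) := by
  rw [prod_map_alternatingWord, prod_map_alternatingWord, M.symmetric t s]
  split_ifs
  · rfl
  · exact eq_comm

variable {S R V : Type*} [CommRing S] [Ring R] [Algebra S R] [AddCommGroup V] [Module S V]

/-- Only the deletions of the first and of the last factor survive, since all other deletions
create the square of a factor. -/
theorem altProd_mul_twisted (L : V → R) {x y : R} {σ τ : Module.End S V} {a b : V → S}
    (hx : x * x = 0) (hy : y * y = 0)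
    (hxL : ∀ l, x * L l = L (σ l) * x + algebraMap S R (a l))
    (hyL : ∀ l, y * L l = L (τ l) * y + algebraMap S R (b l)) (n : ℕ) (l : V) :
    altProd x y (n + 2) * L l = L (altProd σ τ (n + 2) l) * altProd x y (n + 2) +
      algebraMap S R (a (altProd τ σ (n + 1) l)) * altProd y x (n + 1) +
      algebraMap S R (if Even n then b l else a l) * altProd x y (n + 1) := by
  induction n generalizing x y σ τ a b with
  | zero =>
    simp only [altProd, mul_one, mul_assoc, hyL, mul_add, Even.zero, if_true, Module.End.mul_apply]
    rw [← mul_assoc, hxL, add_mul, Algebra.commutes (b l) x, mul_assoc]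
  | succ n ih =>
    have x_mul_xy (c : S) : x * (algebraMap S R c * altProd x y (n + 1)) = 0 := by
      rw [← mul_assoc, ← Algebra.commutes, mul_assoc, altProd, ← mul_assoc x, hx, zero_mul,
        mul_zero]
    have x_mul_yx (c : S) : x * (algebraMap S R c * altProd y x (n + 1)) =
        algebraMap S R c * altProd x y (n + 2) := by
      rw [← mul_assoc, ← Algebra.commutes, mul_assoc]
      rfl
    have parity : (if Even (n + 1) then b l else a l) = if Even n then a l else b l := by
      simp only [Nat.even_add_one, ite_not]
    calc altProd x y (n + 3) * L l = x * (altProd y x (n + 2) * L l) := mul_assoc _ _ _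
      _ = x * L (altProd τ σ (n + 2) l) * altProd y x (n + 2) +
            algebraMap S R (if Even n then a l else b l) * altProd x y (n + 2) := by
          rw [ih hy hx hyL hxL, mul_add, mul_add, x_mul_xy, x_mul_yx, add_zero, mul_assoc]
      _ = _ := by
          rw [hxL, add_mul, mul_assoc, parity]
          rfl

end AlternatingProducts

section DihedralCoroot

variable {B : Type u} (M : CoxeterMatrix B)

theorem coroot_simpleReflection (s t : B) (l : B →₀ ℝ) :
    coroot M s (simpleReflection M t l) =
      coroot M s l + 2 * Real.cos (Real.pi / M s t) * coroot M t l := by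
  simp only [simpleReflection, Module.preReflection_apply, map_sub, map_smul, coroot_simpleRoot,
    smul_eq_mul]
  ring

theorem coroot_simpleReflection_self (s : B) (l : B →₀ ℝ) :
    coroot M s (simpleReflection M s l) = -coroot M s l := by
  rw [coroot_simpleReflection, M.diagonal, Nat.cast_one, div_one, Real.cos_pi]
  ring

theorem coroot_altProd_simpleReflection (s t : B) (k : ℕ) (l : B →₀ ℝ) :
    coroot M s (altProd (simpleReflection M t) (simpleReflection M s) k l) =
      dihedralCoeff (M s t) (k + 1) * coroot M (if Even k then s else t) l +
        dihedralCoeff (M s t) k * coroot M (if Even k then t else s) l := by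
  induction k generalizing l with
  | zero => simp [altProd]
  | succ k ih =>
    rw [altProd_succ_right, Module.End.mul_apply, ih]
    by_cases hk : Even k <;>
    · simp only [hk, Nat.even_add_one, not_true, not_false_iff, if_true, if_false,
        coroot_simpleReflection_self, coroot_simpleReflection, dihedralCoeff_add_two,
        M.symmetric t s]
      ring

theorem coroot_altProd_simpleReflection_pred {s t : B} {n : ℕ} (hn : M s t = n + 2)
    (l : B →₀ ℝ) :
    coroot M s (altProd (simpleReflection M t) (simpleReflection M s) (n + 1) l) =
      if Even n then coroot M s l else coroot M t l := by
  have hself : dihedralCoeff (M s t) (n + 2) = 0 := hn ▸ dihedralCoeff_self (by omega)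
  have hpred : dihedralCoeff (M s t) (n + 1) = 1 := hn ▸ dihedralCoeff_pred (m := n + 2) (by omega)
  rw [coroot_altProd_simpleReflection, hself, hpred, zero_mul, zero_add, one_mul]
  by_cases hk : Even n <;>
    simp only [hk, Nat.even_add_one, not_true, not_false_iff, if_true, if_false]

theorem altProd_simpleReflection {M : CoxeterMatrix B} {W : Type v} [Group W]
    (cs : CoxeterSystem M W) (s t : B) :
    altProd (simpleReflection M s) (simpleReflection M t) (M s t) =
      altProd (simpleReflection M t) (simpleReflection M s) (M s t) := by
  have h := (prod_map_braidWord_eq_iff M cs.simple s t).mp (cs.wordProd_braidWord_eq s t)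
  simpa only [map_altProd, geomRep_simple] using congrArg (geomRep cs) h

end DihedralCoroot

section Demazure

open SymmetricAlgebra (ι)

theorem symmetricAlgebra_ι_injective {S V : Type*} [CommRing S] [AddCommGroup V] [Module S V] :
    Function.Injective (ι S V) := by
  let _ : Module Sᵐᵒᵖ V := Module.compHom V ((RingHom.id S).fromOpposite mul_comm)
  have : IsCentralScalar S V := ⟨fun _ _ => rfl⟩
  intro x y h
  have := congrArg (SymmetricAlgebra.lift (TrivSqZeroExt.inrHom S V)) h
  simpa only [SymmetricAlgebra.lift_ι_apply, TrivSqZeroExt.inrHom_apply,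
    TrivSqZeroExt.inr_injective.eq_iff] using this

theorem ι_simpleRoot_ne_zero {B : Type u} (s : B) : ι ℝ (B →₀ ℝ) (simpleRoot s) ≠ 0 :=
  (map_ne_zero_iff _ symmetricAlgebra_ι_injective).mpr (simpleRoot_ne_zero s)

variable {B : Type u} {M : CoxeterMatrix B} {W : Type v} [Group W] (cs : CoxeterSystem M W)

theorem symAction_ι (w : W) (l : B →₀ ℝ) :
    symAction cs w (ι ℝ _ l) = ι ℝ _ (geomRep cs w l) :=
  SymmetricAlgebra.lift_ι_apply _ _

theorem symAction_simple_ι (s : B) (l : B →₀ ℝ) :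
    symAction cs (cs.simple s) (ι ℝ _ l) = ι ℝ _ (simpleReflection M s l) := by
  rw [symAction_ι, geomRep_simple]

theorem ι_simpleReflection (s : B) (l : B →₀ ℝ) :
    ι ℝ _ (simpleReflection M s l) =
      ι ℝ _ l - algebraMap ℝ (SymR B) (coroot M s l) * ι ℝ _ (simpleRoot s) := by
  rw [simpleReflection, Module.preReflection_apply, map_sub, map_smul, Algebra.smul_def]

theorem symAction_simple_ι_simpleRoot (s : B) :
    symAction cs (cs.simple s) (ι ℝ _ (simpleRoot s)) = -ι ℝ _ (simpleRoot s) := by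
  rw [symAction_simple_ι, simpleReflection_simpleRoot_self, map_neg]

theorem ι_simpleRoot_dvd_sub_symAction (s : B) (f : SymR B) :
    ι ℝ _ (simpleRoot s) ∣ f - symAction cs (cs.simple s) f := by
  induction f using SymmetricAlgebra.induction with
  | algebraMap r => simp
  | ι l =>
    rw [symAction_simple_ι, ι_simpleReflection, sub_sub_cancel]
    exact dvd_mul_left _ _
  | add f g hf hg =>
    rw [map_add, add_sub_add_comm]
    exact dvd_add hf hg
  | mul f g hf hg =>
    have h : f * g - symAction cs (cs.simple s) (f * g) =
        (f - symAction cs (cs.simple s) f) * g +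
          symAction cs (cs.simple s) f * (g - symAction cs (cs.simple s) g) := by
      rw [map_mul]; ring
    exact h ▸ dvd_add (hf.mul_right g) (hg.mul_left _)

/-- The Demazure operator `f ↦ (f - s f) / αₛ` on `R = Sym(𝔥*)`. -/
noncomputable def demazure (s : B) : Module.End (invariants cs) (SymR B) where
  toFun f := (ι_simpleRoot_dvd_sub_symAction cs s f).choose
  map_add' f g := mul_left_cancel₀ (ι_simpleRoot_ne_zero s) <| by
    rw [mul_add]
    iterate 3 rw [← (ι_simpleRoot_dvd_sub_symAction cs s _).choose_spec]
    rw [map_add]; ring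
  map_smul' a f := mul_left_cancel₀ (ι_simpleRoot_ne_zero s) <| by
    have ha : symAction cs (cs.simple s) a = a := a.2 _
    rw [RingHom.id_apply, mul_smul_comm]
    iterate 2 rw [← (ι_simpleRoot_dvd_sub_symAction cs s _).choose_spec]
    rw [Subalgebra.smul_def, Subalgebra.smul_def, smul_eq_mul, smul_eq_mul, map_mul, ha, mul_sub]

theorem ι_mul_demazure (s : B) (f : SymR B) :
    ι ℝ _ (simpleRoot s) * demazure cs s f = f - symAction cs (cs.simple s) f :=
  (ι_simpleRoot_dvd_sub_symAction cs s f).choose_spec.symm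

theorem demazure_eq_of_ι_mul_eq {s : B} {f g : SymR B}
    (h : ι ℝ _ (simpleRoot s) * g = f - symAction cs (cs.simple s) f) : demazure cs s f = g :=
  mul_left_cancel₀ (ι_simpleRoot_ne_zero s) ((ι_mul_demazure cs s f).trans h.symm)

theorem demazure_mul (s : B) (f g : SymR B) :
    demazure cs s (f * g) = symAction cs (cs.simple s) f * demazure cs s g + demazure cs s f * g :=
  demazure_eq_of_ι_mul_eq cs <| by
    rw [map_mul]
    linear_combination g * ι_mul_demazure cs s f +
      symAction cs (cs.simple s) f * ι_mul_demazure cs s g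

theorem demazure_one (s : B) : demazure cs s 1 = 0 :=
  demazure_eq_of_ι_mul_eq cs (by simp)

theorem demazure_ι (s : B) (l : B →₀ ℝ) :
    demazure cs s (ι ℝ _ l) = algebraMap ℝ _ (coroot M s l) :=
  demazure_eq_of_ι_mul_eq cs <| by
    rw [symAction_simple_ι, ι_simpleReflection]
    ring

theorem symAction_simple_self (s : B) (f : SymR B) :
    symAction cs (cs.simple s) (symAction cs (cs.simple s) f) = f := by
  rw [← AlgHom.mul_apply, ← map_mul, cs.simple_mul_simple_self, map_one, AlgHom.one_apply]

theorem demazure_eq_zero_iff {s : B} {f : SymR B} :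
    demazure cs s f = 0 ↔ symAction cs (cs.simple s) f = f := by
  rw [← mul_right_inj' (ι_simpleRoot_ne_zero s), ι_mul_demazure, mul_zero, sub_eq_zero, eq_comm]

theorem symAction_demazure (s : B) (f : SymR B) :
    symAction cs (cs.simple s) (demazure cs s f) = demazure cs s f := by
  have h := congrArg (symAction cs (cs.simple s)) (ι_mul_demazure cs s f)
  rw [map_mul, map_sub, symAction_simple_self, symAction_simple_ι_simpleRoot] at h
  refine mul_left_cancel₀ (ι_simpleRoot_ne_zero s) ?_
  rw [ι_mul_demazure]
  linear_combination -h

theorem demazure_mul_self (s : B) : demazure cs s * demazure cs s = 0 :=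
  LinearMap.ext fun f => (demazure_eq_zero_iff cs).mpr (symAction_demazure cs s f)

theorem mem_invariants_of_demazure_eq_zero {f : SymR B} (h : ∀ s, demazure cs s f = 0) :
    f ∈ invariants cs := by
  intro w
  induction w using cs.simple_induction_left with
  | one => simp
  | mul_simple_left w s hw =>
    rw [map_mul, AlgHom.mul_apply, hw, (demazure_eq_zero_iff cs).mp (h s)]

/-- Multiplication by a weight on `R = Sym(𝔥*)`. -/
noncomputable def weightMul (l : B →₀ ℝ) : Module.End (invariants cs) (SymR B) :=
  LinearMap.mulLeft _ (ι ℝ _ l)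

theorem weightMul_apply (l : B →₀ ℝ) (f : SymR B) : weightMul cs l f = ι ℝ _ l * f := rfl

theorem algebraMap_end_invariants_apply (c : ℝ) (f : SymR B) :
    algebraMap ℝ (Module.End (invariants cs) (SymR B)) c f = algebraMap ℝ _ c * f := by
  rw [Module.algebraMap_end_apply, Algebra.smul_def]

theorem demazure_mul_weightMul (s : B) (l : B →₀ ℝ) :
    demazure cs s * weightMul cs l =
      weightMul cs (simpleReflection M s l) * demazure cs s + algebraMap ℝ _ (coroot M s l) := by
  refine LinearMap.ext fun f => ?_
  rw [Module.End.mul_apply, weightMul_apply, demazure_mul, symAction_simple_ι, demazure_ι,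
    LinearMap.add_apply, algebraMap_end_invariants_apply, Module.End.mul_apply, weightMul_apply]

theorem altProd_demazure_one (s t : B) (n : ℕ) :
    altProd (demazure cs s) (demazure cs t) (n + 1) 1 = 0 := by
  rw [altProd_succ_right, Module.End.mul_apply]
  split_ifs <;> rw [demazure_one, map_zero]

theorem eq_zero_of_mul_weightMul {Z : Module.End (invariants cs) (SymR B)}
    {σ : (B →₀ ℝ) → (B →₀ ℝ)} (hZ : ∀ l, Z * weightMul cs l = weightMul cs (σ l) * Z)
    (hZ1 : Z 1 = 0) : Z = 0 := by
  have ker_mul (f : SymR B) : ∀ g, Z g = 0 → Z (f * g) = 0 := by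
    induction f using SymmetricAlgebra.induction with
    | algebraMap r =>
      intro g hg
      have := map_smul Z (algebraMap ℝ (invariants cs) r) g
      rw [hg, smul_zero] at this
      exact this
    | ι l =>
      intro g hg
      have := LinearMap.congr_fun (hZ l) g
      rwa [Module.End.mul_apply, Module.End.mul_apply, hg, map_zero] at this
    | add f f' hf hf' =>
      intro g hg
      rw [add_mul, map_add, hf g hg, hf' g hg, add_zero]
    | mul f f' hf hf' =>
      intro g hg
      rw [mul_assoc]
      exact hf _ (hf' g hg)
  exact LinearMap.ext fun f => by simpa using ker_mul f 1 hZ1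

theorem altProd_demazure (s t : B) :
    altProd (demazure cs s) (demazure cs t) (M s t) =
      altProd (demazure cs t) (demazure cs s) (M s t) := by
  rcases eq_or_ne s t with rfl | hst
  · rfl
  have hbraid := altProd_simpleReflection cs s t
  rcases hm : M s t with _ | _ | n
  · rfl
  · exact absurd hm (M.off_diagonal s t hst)
  have hm' : M t s = n + 2 := (M.symmetric t s).trans hm
  rw [hm] at hbraid
  rw [← sub_eq_zero]
  refine eq_zero_of_mul_weightMul cs
    (σ := fun l => altProd (simpleReflection M s) (simpleReflection M t) (n + 2) l)
    (fun l => ?_) ?_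
  · rw [sub_mul,
      altProd_mul_twisted (weightMul cs) (demazure_mul_self cs s) (demazure_mul_self cs t)
        (demazure_mul_weightMul cs s) (demazure_mul_weightMul cs t),
      altProd_mul_twisted (weightMul cs) (demazure_mul_self cs t) (demazure_mul_self cs s)
        (demazure_mul_weightMul cs t) (demazure_mul_weightMul cs s),
      coroot_altProd_simpleReflection_pred M hm, coroot_altProd_simpleReflection_pred M hm',
      ← hbraid, mul_sub]
    abel
  · rw [LinearMap.sub_apply, altProd_demazure_one, altProd_demazure_one, sub_zero]

/-- The representation `ρ` of the nil Hecke algebra on `R = Sym(𝔥*)`, by multiplication operators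
and Demazure operators. -/
noncomputable def nilHeckeRep : NilHecke M →ₐ[ℝ] Module.End (invariants cs) (SymR B) :=
  RingQuot.liftAlgHom (s := NilHeckeRel M) ℝ
    ⟨FreeAlgebra.lift ℝ (Sum.elim (weightMul cs) (demazure cs)), by
      intro x y h
      induction h with
      | add l m =>
        simp only [map_add, FreeAlgebra.lift_ι_apply, Sum.elim_inl]
        exact LinearMap.ext fun f => by
          simp only [weightMul_apply, LinearMap.add_apply, map_add, add_mul]
      | smul c l =>
        simp only [map_smul, FreeAlgebra.lift_ι_apply, Sum.elim_inl]
        exact LinearMap.ext fun f => by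
          simp only [weightMul_apply, LinearMap.smul_apply, map_smul, smul_mul_assoc]
      | comm l m =>
        simp only [map_mul, FreeAlgebra.lift_ι_apply, Sum.elim_inl]
        exact LinearMap.ext fun f => mul_left_comm (ι ℝ _ l) (ι ℝ _ m) f
      | weyl s l =>
        simp only [map_mul, map_add, FreeAlgebra.lift_ι_apply, Sum.elim_inl, Sum.elim_inr,
          AlgHom.commutes]
        exact demazure_mul_weightMul cs s l
      | sq s =>
        simp only [map_mul, map_zero, FreeAlgebra.lift_ι_apply, Sum.elim_inr]
        exact demazure_mul_self cs s
      | braid s t =>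
        simp only [map_altProd, FreeAlgebra.lift_ι_apply, Sum.elim_inr]
        exact altProd_demazure cs s t⟩

theorem nilHeckeRep_mk (x : FreeAlgebra ℝ ((B →₀ ℝ) ⊕ B)) :
    nilHeckeRep cs (NilHecke.mk M x) =
      FreeAlgebra.lift ℝ (Sum.elim (weightMul cs) (demazure cs)) x :=
  RingQuot.liftAlgHom_mkAlgHom_apply ..

theorem nilHeckeRep_weight (l : B →₀ ℝ) :
    nilHeckeRep cs (NilHecke.weight M l) = weightMul cs l :=
  (nilHeckeRep_mk cs _).trans (FreeAlgebra.lift_ι_apply _ _)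

theorem nilHeckeRep_del (s : B) : nilHeckeRep cs (NilHecke.del M s) = demazure cs s :=
  (nilHeckeRep_mk cs _).trans (FreeAlgebra.lift_ι_apply _ _)

theorem nilHeckeRep_reflElt (s : B) (f : SymR B) :
    nilHeckeRep cs (NilHecke.reflElt M s) f = symAction cs (cs.simple s) f := by
  rw [NilHecke.reflElt, map_sub, map_mul, map_one, nilHeckeRep_weight, nilHeckeRep_del,
    LinearMap.sub_apply, Module.End.mul_apply, weightMul_apply, ι_mul_demazure,
    Module.End.one_apply, sub_sub_cancel]

theorem nilHeckeRep_ofSym (f g : SymR B) : nilHeckeRep cs (NilHecke.ofSym M f) g = f * g := by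
  induction f using SymmetricAlgebra.induction generalizing g with
  | algebraMap r => rw [AlgHom.commutes, AlgHom.commutes, algebraMap_end_invariants_apply]
  | ι l => rw [NilHecke.ofSym_ι, nilHeckeRep_weight, weightMul_apply]
  | add f f' hf hf' => rw [map_add, map_add, LinearMap.add_apply, hf, hf', add_mul]
  | mul f f' hf hf' => rw [map_mul, map_mul, Module.End.mul_apply, hf', hf, mul_assoc]

theorem nilHeckeRep_smul (f : SymR B) (h : NilHecke M) (g : SymR B) :
    nilHeckeRep cs (f • h) g = f * nilHeckeRep cs h g := by
  rw [NilHecke.smul_def, map_mul, Module.End.mul_apply, nilHeckeRep_ofSym]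

end Demazure

namespace NilHecke

open SymmetricAlgebra (ι)

variable {B : Type u} (M : CoxeterMatrix B)

theorem del_mul_weight (s : B) (l : B →₀ ℝ) : del M s * weight M l =
    weight M (simpleReflection M s l) * del M s + algebraMap ℝ _ (coroot M s l) := by
  change mk M _ * mk M _ = mk M _ * mk M _ + _
  rw [← map_mul, mk_rel M (.weyl s l), map_add, map_mul, AlgHom.commutes]

theorem del_mul_del (s : B) : del M s * del M s = 0 := by
  change mk M _ * mk M _ = 0
  rw [← map_mul, mk_rel M (.sq s), map_zero]

theorem altProd_del (s t : B) :
    altProd (del M s) (del M t) (M s t) = altProd (del M t) (del M s) (M s t) := by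
  change altProd (mk M _) (mk M _) _ = altProd (mk M _) (mk M _) _
  rw [← map_altProd, mk_rel M (.braid s t), map_altProd]

variable {M}

theorem induction {p : NilHecke M → Prop} (algebraMap : ∀ r, p (algebraMap ℝ _ r))
    (weight : ∀ l, p (weight M l)) (del : ∀ s, p (del M s))
    (mul : ∀ x y, p x → p y → p (x * y)) (add : ∀ x y, p x → p y → p (x + y))
    (h : NilHecke M) : p h := by
  obtain ⟨x, rfl⟩ := RingQuot.mkAlgHom_surjective ℝ (NilHeckeRel M) h
  induction x using FreeAlgebra.induction with
  | grade0 r => exact (AlgHom.commutes (mk M) r).symm ▸ algebraMap r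
  | grade1 i => exact i.casesOn weight del
  | mul x y hx hy => exact (map_mul (mk M) x y).symm ▸ mul _ _ hx hy
  | add x y hx hy => exact (map_add (mk M) x y).symm ▸ add _ _ hx hy

variable {W : Type v} [Group W] (cs : CoxeterSystem M W)

theorem del_mul_ofSym (s : B) (f : SymR B) : del M s * ofSym M f =
    ofSym M (symAction cs (cs.simple s) f) * del M s + ofSym M (demazure cs s f) := by
  induction f using SymmetricAlgebra.induction with
  | algebraMap r =>
    have : demazure cs s (algebraMap ℝ _ r) = 0 := (demazure_eq_zero_iff cs).mpr (by simp)
    rw [this, AlgHom.commutes, AlgHom.commutes, AlgHom.commutes, map_zero, add_zero,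
      Algebra.commutes]
  | ι l =>
    rw [symAction_simple_ι, demazure_ι, AlgHom.commutes, ofSym_ι, ofSym_ι, del_mul_weight]
  | add f g hf hg =>
    simp only [map_add, mul_add, add_mul, hf, hg]
    abel
  | mul f g hf hg =>
    rw [map_mul, ← mul_assoc, hf, add_mul, mul_assoc, hg, demazure_mul, map_add, map_mul, map_mul,
      map_mul, map_mul, mul_add, mul_assoc, add_assoc]

section Module

variable {N : Type*} [AddCommGroup N] [Module (NilHecke M) N]

theorem smul_ofSym_smul {d : N} (hd : ∀ s, del M s • d = 0) (h : NilHecke M) (f : SymR B) :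
    h • ofSym M f • d = ofSym M (nilHeckeRep cs h f) • d := by
  induction h using NilHecke.induction generalizing f with
  | algebraMap r =>
    rw [AlgHom.commutes, algebraMap_end_invariants_apply, map_mul, AlgHom.commutes, mul_smul]
  | weight l => rw [nilHeckeRep_weight, weightMul_apply, map_mul, ofSym_ι, mul_smul]
  | del s =>
    rw [nilHeckeRep_del, ← mul_smul, del_mul_ofSym cs, add_smul, mul_smul, hd, smul_zero, zero_add]
  | mul x y hx hy => rw [mul_smul, hy, hx, map_mul, Module.End.mul_apply]
  | add x y hx hy => rw [add_smul, hx, hy, map_add, LinearMap.add_apply, map_add, add_smul]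

end Module

theorem sub_ofSym_mem_span_del (h : NilHecke M) :
    h - ofSym M (nilHeckeRep cs h 1) ∈ Ideal.span (Set.range (del M)) := by
  let L := Ideal.span (Set.range (del M))
  have hdel (s : B) : del M s • (Submodule.mkQ L 1) = 0 := by
    rw [← map_smul, smul_eq_mul, mul_one, Submodule.mkQ_apply, Submodule.Quotient.mk_eq_zero]
    exact Ideal.subset_span ⟨s, rfl⟩
  have := smul_ofSym_smul cs hdel h 1
  rw [map_one, one_smul, ← map_smul, ← map_smul, smul_eq_mul, smul_eq_mul, mul_one, mul_one] at this
  exact (Submodule.Quotient.eq L).mp this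

theorem prod_map_del_eq_zero {ω : List B} (hω : ¬ cs.IsReduced ω) : (ω.map (del M)).prod = 0 :=
  prod_map_eq_zero_of_not_isReduced cs
    (fun s t => (prod_map_braidWord_eq_iff M _ s t).mpr (altProd_del M s t)) (del_mul_del M) hω

theorem prod_map_del_eq_zero_of_length_lt {ω : List B} (hω : ∀ w, cs.length w < ω.length) :
    (ω.map (del M)).prod = 0 :=
  prod_map_del_eq_zero cs fun h => (hω _).ne h

/-- The elements of `I` with constant term `1` move a product of the `∂ₛ` to the longer ones, all of
which vanish eventually. -/
theorem one_mem_of_nilHeckeRep_one_eq [Finite W] {I : TwoSidedIdeal (NilHecke M)} {x : NilHecke M}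
    (hx : x ∈ I) (hx1 : nilHeckeRep cs x 1 = 1) : 1 ∈ I := by
  have hxL : x - 1 ∈ Ideal.span (Set.range (del M)) := by
    simpa only [hx1, map_one] using sub_ofSym_mem_span_del cs x
  obtain ⟨w₀, hw₀⟩ := Finite.exists_max cs.length
  have mem_of_forall_cons_mem {z : NilHecke M} (hz : ∀ s, del M s * z ∈ I) : z ∈ I := by
    have hxz : (x - 1) * z ∈ I := by
      generalize x - 1 = g at hxL
      induction hxL using Submodule.span_induction with
      | mem y hy =>
        obtain ⟨s, rfl⟩ := hy
        exact hz s
      | zero => exact (zero_mul z).symm ▸ I.zero_mem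
      | add a b _ _ ha hb => exact (add_mul a b z).symm ▸ I.add_mem ha hb
      | smul c a _ ha => exact (mul_assoc c a z).symm ▸ I.mul_mem_left c _ ha
    simpa [sub_mul] using I.sub_mem (I.mul_mem_right _ z hx) hxz
  have prod_mem (n : ℕ) (ω : List B) (hn : cs.length w₀ + 1 = ω.length + n) :
      (ω.map (del M)).prod ∈ I := by
    induction n generalizing ω with
    | zero =>
      rw [prod_map_del_eq_zero_of_length_lt cs fun w => by have := hw₀ w; omega]
      exact I.zero_mem
    | succ n ih =>
      refine mem_of_forall_cons_mem fun s => ?_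
      simpa using ih (s :: ω) (by rw [List.length_cons]; omega)
  simpa using prod_mem (cs.length w₀ + 1) [] (Nat.zero_add _).symm

end NilHecke

section Expansion

open SymmetricAlgebra (ι)

variable {B : Type u} {M : CoxeterMatrix B} {W : Type v} [Group W] (cs : CoxeterSystem M W)

theorem symAction_injective : Function.Injective (symAction cs) := by
  intro w w' h
  refine geomRep_injective cs (LinearMap.ext fun l => symmetricAlgebra_ι_injective (S := ℝ) ?_)
  rw [← symAction_ι, ← symAction_ι, h]

theorem symAction_apply_injective (w : W) : Function.Injective (symAction cs w) := by
  refine Function.LeftInverse.injective (g := symAction cs w⁻¹) fun f => ?_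
  rw [← AlgHom.mul_apply, ← map_mul, inv_mul_cancel, map_one, AlgHom.one_apply]

/-- The action of `W` on the fraction field of `R = Sym(𝔥*)`. -/
noncomputable def fracAction (w : W) : FractionRing (SymR B) →+* FractionRing (SymR B) :=
  IsFractionRing.map (j := (symAction cs w : SymR B →+* SymR B)) (symAction_apply_injective cs w)

theorem fracAction_algebraMap (w : W) (f : SymR B) :
    fracAction cs w (algebraMap (SymR B) _ f) = algebraMap (SymR B) _ (symAction cs w f) :=
  IsLocalization.map_eq (S := FractionRing (SymR B)) (Q := FractionRing (SymR B))
    (nonZeroDivisors_le_comap_nonZeroDivisors_of_injective _ (symAction_apply_injective cs w)) f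

theorem algebraMap_ι_simpleRoot_ne_zero (s : B) :
    algebraMap (SymR B) (FractionRing (SymR B)) (ι ℝ _ (simpleRoot s)) ≠ 0 :=
  FaithfulSMul.algebraMap_eq_zero_iff (SymR B) (FractionRing (SymR B)) |>.not.mpr
    (ι_simpleRoot_ne_zero s)

theorem linearIndependent_symAction :
    LinearIndependent (FractionRing (SymR B))
      (fun (w : W) (f : SymR B) => algebraMap (SymR B) (FractionRing (SymR B))
        (symAction cs w f)) := by
  refine (linearIndependent_monoidHom (SymR B) (FractionRing (SymR B))).comp
    (fun w : W => ((algebraMap (SymR B) (FractionRing (SymR B))).comp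
      (symAction cs w : SymR B →+* SymR B) : SymR B →* FractionRing (SymR B))) fun w w' h => ?_
  refine symAction_injective cs (AlgHom.ext fun f => ?_)
  exact FaithfulSMul.algebraMap_injective (SymR B) (FractionRing (SymR B)) (DFunLike.congr_fun h f)

variable [Fintype W]

/-- The operator `T` on `R` equals `∑ c_w w` in the twisted group ring of `W` over the fraction
field of `R`. -/
def HasExpansion (T : Module.End (invariants cs) (SymR B)) (c : W → FractionRing (SymR B)) : Prop :=
  ∀ f, algebraMap (SymR B) (FractionRing (SymR B)) (T f) =
    ∑ w, c w * algebraMap (SymR B) (FractionRing (SymR B)) (symAction cs w f)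

namespace HasExpansion

variable {cs} {T : Module.End (invariants cs) (SymR B)} {c c' : W → FractionRing (SymR B)}

theorem zero : HasExpansion cs 0 0 := fun f => by simp

theorem one [DecidableEq W] : HasExpansion cs 1 (Pi.single 1 1) := fun f => by
  simp [Pi.single_apply]

theorem unique (hc : HasExpansion cs T c) (hc' : HasExpansion cs T c') : c = c' := by
  refine linearIndependent_iff_injective_fintypeLinearCombination.mp
    (linearIndependent_symAction cs) ?_
  ext f
  simpa [Fintype.linearCombination_apply] using (hc f).symm.trans (hc' f)

theorem demazure_mul (hc : HasExpansion cs T c) (s : B) : HasExpansion cs (demazure cs s * T)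
    fun w => (algebraMap (SymR B) _ (ι ℝ _ (simpleRoot s)))⁻¹ *
      (c w - fracAction cs (cs.simple s) (c (cs.simple s * w))) := by
  intro f
  have hsT : algebraMap (SymR B) (FractionRing (SymR B)) (symAction cs (cs.simple s) (T f)) =
      ∑ w, fracAction cs (cs.simple s) (c (cs.simple s * w)) *
        algebraMap _ _ (symAction cs w f) := by
    rw [← fracAction_algebraMap, hc, map_sum, ← Equiv.sum_comp (Equiv.mulLeft (cs.simple s))]
    refine Finset.sum_congr rfl fun w _ => ?_
    rw [Equiv.coe_mulLeft, map_mul, fracAction_algebraMap, ← AlgHom.mul_apply, ← map_mul,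
      cs.simple_mul_simple_cancel_left]
  refine mul_left_cancel₀ (algebraMap_ι_simpleRoot_ne_zero s) ?_
  simp_rw [mul_assoc]
  rw [Module.End.mul_apply, ← map_mul, ι_mul_demazure, map_sub, hsT, hc, ← Finset.mul_sum,
    mul_inv_cancel_left₀ (algebraMap_ι_simpleRoot_ne_zero s), ← Finset.sum_sub_distrib]
  simp_rw [sub_mul]

theorem fracAction_simple_apply (hc : HasExpansion cs T c) {s : B} (hT : demazure cs s * T = 0)
    (w : W) : fracAction cs (cs.simple s) (c w) = c (cs.simple s * w) := by
  have h := congrFun (unique (hT ▸ hc.demazure_mul s) zero) (cs.simple s * w)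
  rw [Pi.zero_apply, mul_eq_zero, inv_eq_zero] at h
  have := h.resolve_left (algebraMap_ι_simpleRoot_ne_zero s)
  rwa [cs.simple_mul_simple_cancel_left, sub_eq_zero, eq_comm] at this

end HasExpansion

/-- The coefficient of `wordProd ω` is the inverse of a product of roots. -/
theorem exists_hasExpansion_prod_map_demazure (ω : List B) :
    ∃ c, HasExpansion cs (ω.map (demazure cs)).prod c ∧
      (∀ w, ω.length < cs.length w → c w = 0) ∧
      (cs.IsReduced ω → ∃ Q, c (cs.wordProd ω) * algebraMap (SymR B) _ Q = 1) := by
  induction ω with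
  | nil =>
    classical
    refine ⟨Pi.single 1 1, HasExpansion.one, fun w hw => Pi.single_eq_of_ne ?_ _,
      fun _ => ⟨1, by simp⟩⟩
    rintro rfl
    simp at hw
  | cons s ω ih =>
    obtain ⟨c, hc, hsupp, hlead⟩ := ih
    refine ⟨_, hc.demazure_mul s, fun w hw => ?_, fun hω => ?_⟩
    · rw [List.length_cons] at hw
      have := cs.length_simple_mul w s
      rw [hsupp w (by omega), hsupp (cs.simple s * w) (by omega), map_zero, sub_zero, mul_zero]
    · obtain ⟨Q, hQ⟩ := hlead (by simpa using hω.drop 1)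
      have h0 : c (cs.wordProd (s :: ω)) = 0 := hsupp _ (by rw [hω.eq]; simp)
      refine ⟨-(ι ℝ _ (simpleRoot s) * symAction cs (cs.simple s) Q), ?_⟩
      rw [h0, zero_sub, cs.wordProd_cons, cs.simple_mul_simple_cancel_left, map_neg, map_mul,
        mul_neg, mul_neg, neg_mul, neg_neg, mul_mul_mul_comm,
        inv_mul_cancel₀ (algebraMap_ι_simpleRoot_ne_zero s), one_mul, ← fracAction_algebraMap,
        ← map_mul, hQ, map_one]

theorem exists_prod_map_demazure_eq_card {ω : List B} (hω : cs.IsReduced ω)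
    (hd : ∀ s, demazure cs s * (ω.map (demazure cs)).prod = 0) :
    ∃ f, (ω.map (demazure cs)).prod f = Fintype.card W := by
  obtain ⟨c, hc, -, hlead⟩ := exists_hasExpansion_prod_map_demazure cs ω
  obtain ⟨Q, hQ⟩ := hlead hω
  have hcoeff (w : W) : c (w * cs.wordProd ω) * algebraMap (SymR B) _ (symAction cs w Q) = 1 := by
    induction w using cs.simple_induction_left with
    | one => simpa using hQ
    | mul_simple_left w s hw =>
      rw [mul_assoc, ← hc.fracAction_simple_apply (hd s), map_mul, AlgHom.mul_apply,
        ← fracAction_algebraMap, ← map_mul, hw, map_one]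
  refine ⟨symAction cs (cs.wordProd ω)⁻¹ Q,
    FaithfulSMul.algebraMap_injective (SymR B) (FractionRing (SymR B)) ?_⟩
  rw [hc, ← Equiv.sum_comp (Equiv.mulRight (cs.wordProd ω)), map_natCast, ← Finset.card_univ,
    ← nsmul_one, ← Finset.sum_const]
  refine Finset.sum_congr rfl fun w _ => ?_
  rw [Equiv.coe_mulRight, ← AlgHom.mul_apply, ← map_mul, mul_inv_cancel_right, hcoeff]

end Expansion

section DualBasis

/-- A representation `ρ` of a ring `H` over `R` by `R'`-linear endomorphisms of `R`, with elements
`aᵢ` of `R` and `cᵢ` of `H` such that the `aᵢ` and the functionals `ρ cᵢ : R → R'` form a dual basis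
of the `R'`-module `R`, and such that the resulting expansion of `ρ h` lifts to `H`. -/
structure IsDualBasisRep {R' R H ι : Type*} [CommRing R'] [CommRing R] [Algebra R' R] [Ring H]
    [Module R H] [Fintype ι] (ρ : H →+* Module.End R' R) (a : ι → R) (c : ι → H) : Prop where
  smul_apply : ∀ (r : R) (h : H) (f : R), ρ (r • h) f = r * ρ h f
  apply_mem_range : ∀ i f, ρ (c i) f ∈ Set.range (algebraMap R' R)
  eq_sum : ∀ h, h = ∑ i, ρ h (a i) • c i

namespace IsDualBasisRep

section Coalgebra

variable {R' R H ι : Type*} [CommRing R'] [CommRing R] [Algebra R' R] [Ring H] [Module R H]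
  [Fintype ι] {ρ : H →+* Module.End R' R} {a : ι → R} {c : ι → H}

theorem injective (D : IsDualBasisRep ρ a c) : Function.Injective ρ := by
  intro g h hgh
  rw [D.eq_sum g, D.eq_sum h, hgh]

theorem ext (D : IsDualBasisRep ρ a c) {g h : H} (hgh : ∀ f, ρ g f = ρ h f) : g = h :=
  D.injective (LinearMap.ext hgh)

theorem sum_mul_apply (D : IsDualBasisRep ρ a c) (f : R) : ∑ i, a i * ρ (c i) f = f := by
  have h := congrArg (fun h => ρ h f) (D.eq_sum 1)
  simp only [map_sum, LinearMap.sum_apply, D.smul_apply, map_one, Module.End.one_apply] at h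
  exact h.symm

theorem map_mul_apply (D : IsDualBasisRep ρ a c) (φ : Module.End R' R) (i : ι) (f g : R) :
    φ (g * ρ (c i) f) = φ g * ρ (c i) f := by
  obtain ⟨r, hr⟩ := D.apply_mem_range i f
  rw [← hr, mul_comm, ← Algebra.smul_def, map_smul, Algebra.smul_def, mul_comm]

/-- The preimage `∑ φ(aᵢ) cᵢ` of `φ` under `ρ`. -/
def ofEnd (a : ι → R) (c : ι → H) (φ : Module.End R' R) : H := ∑ i, φ (a i) • c i

theorem apply_ofEnd (D : IsDualBasisRep ρ a c) (φ : Module.End R' R) : ρ (ofEnd a c φ) = φ := by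
  refine LinearMap.ext fun f => ?_
  conv_rhs => rw [← D.sum_mul_apply f, map_sum]
  simp only [ofEnd, map_sum, LinearMap.sum_apply, D.smul_apply, D.map_mul_apply]

theorem bijective (D : IsDualBasisRep ρ a c) : Function.Bijective ρ :=
  ⟨D.injective, fun φ => ⟨_, D.apply_ofEnd φ⟩⟩

theorem mul_smul_one_apply (D : IsDualBasisRep ρ a c) (h : H) (r f : R) :
    ρ (h * (r • (1 : H))) f = ρ h (r * f) := by
  rw [map_mul, Module.End.mul_apply, D.smul_apply, map_one, Module.End.one_apply]

variable (D : IsDualBasisRep ρ a c)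

/-- The `R`-linear map `h ↦ ρ h f`. -/
def evalAt (f : R) : H →ₗ[R] R where
  toFun h := ρ h f
  map_add' g h := by rw [map_add, LinearMap.add_apply]
  map_smul' r h := D.smul_apply r h f

@[simp] theorem evalAt_apply (f : R) (h : H) : D.evalAt f h = ρ h f := rfl

/-- Evaluation of the left tensor factor at `f`. -/
def slice (N : Type*) [AddCommGroup N] [Module R N] (f : R) : H ⊗[R] N →ₗ[R] N :=
  (TensorProduct.lid R N).toLinearMap ∘ₗ (D.evalAt f).rTensor N

section Slice

variable {N N' : Type*} [AddCommGroup N] [Module R N] [AddCommGroup N'] [Module R N']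

@[simp] theorem slice_tmul (f : R) (h : H) (x : N) : D.slice N f (h ⊗ₜ x) = ρ h f • x := by
  simp [slice]

theorem sum_tmul_slice (y : H ⊗[R] N) : ∑ i, c i ⊗ₜ D.slice N (a i) y = y := by
  induction y with
  | zero => simp
  | add y z hy hz => simp only [map_add, TensorProduct.tmul_add, Finset.sum_add_distrib, hy, hz]
  | tmul h x =>
    simp only [D.slice_tmul, ← TensorProduct.smul_tmul]
    rw [← TensorProduct.sum_tmul, ← D.eq_sum]

theorem slice_ext {y z : H ⊗[R] N} (h : ∀ f, D.slice N f y = D.slice N f z) : y = z := by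
  rw [← D.sum_tmul_slice y, ← D.sum_tmul_slice z]
  simp only [h]

theorem slice_lTensor (φ : N →ₗ[R] N') (f : R) (y : H ⊗[R] N) :
    D.slice N' f (φ.lTensor H y) = φ (D.slice N f y) := by
  have : D.slice N' f ∘ₗ φ.lTensor H = φ ∘ₗ D.slice N f := TensorProduct.ext' fun h x => by simp
  exact LinearMap.congr_fun this y

end Slice

/-- The pairing `∑ xᵢ ⊗ yᵢ ↦ ∑ ρ xᵢ f * ρ yᵢ g`. -/
def pairing (f g : R) : H ⊗[R] H →ₗ[R] R := D.evalAt g ∘ₗ D.slice H f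

theorem apply_slice (f g : R) (z : H ⊗[R] H) : ρ (D.slice H f z) g = D.pairing f g z := rfl

@[simp] theorem pairing_tmul (f g : R) (x y : H) :
    D.pairing f g (x ⊗ₜ y) = ρ x f * ρ y g := by
  rw [← apply_slice, slice_tmul, D.smul_apply]

theorem pairing_ext {y z : H ⊗[R] H} (h : ∀ f g, D.pairing f g y = D.pairing f g z) : y = z :=
  D.slice_ext fun f => D.ext (h f)

theorem pairing_comm (f g : R) (z : H ⊗[R] H) :
    D.pairing f g (TensorProduct.comm R H H z) = D.pairing g f z := by
  have : D.pairing f g ∘ₗ (TensorProduct.comm R H H).toLinearMap = D.pairing g f :=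
    TensorProduct.ext' fun x y => by simp [mul_comm]
  exact LinearMap.congr_fun this z

theorem slice_slice_assoc_tmul {N : Type*} [AddCommGroup N] [Module R N] (f g : R) (z : H ⊗[R] H)
    (x : N) : D.slice N g (D.slice (H ⊗[R] N) f (TensorProduct.assoc R H H N (z ⊗ₜ x))) =
      D.pairing f g z • x := by
  induction z with
  | zero => simp
  | add y z hy hz => simp only [map_add, TensorProduct.add_tmul, add_smul, hy, hz]
  | tmul y z => simp [mul_smul]

/-- The comultiplication dual to the multiplication of `R`. -/
def comul : H →ₗ[R] H ⊗[R] H :=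
  ∑ i, ∑ j, (D.evalAt (a i * a j)).smulRight (c i ⊗ₜ c j)

theorem pairing_comul (f g : R) (h : H) : D.pairing f g (D.comul h) = ρ h (f * g) := by
  have hfg : f * g = ∑ i, ∑ j, a i * a j * ρ (c j) g * ρ (c i) f := by
    conv_lhs => rw [← D.sum_mul_apply f, ← D.sum_mul_apply g, Finset.sum_mul_sum]
    refine Finset.sum_congr rfl fun i _ => Finset.sum_congr rfl fun j _ => ?_
    ring
  rw [hfg]
  simp only [comul, LinearMap.sum_apply, LinearMap.smulRight_apply, map_sum, map_smul,
    pairing_tmul, evalAt_apply, D.map_mul_apply, smul_eq_mul]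
  refine Finset.sum_congr rfl fun i _ => Finset.sum_congr rfl fun j _ => ?_
  ring

theorem apply_slice_comul (f g : R) (h : H) : ρ (D.slice H f (D.comul h)) g = ρ h (f * g) :=
  D.pairing_comul f g h

theorem slice_one_comul (h : H) : D.slice H 1 (D.comul h) = h :=
  D.ext fun g => by rw [apply_slice_comul, one_mul]

theorem comm_comul (h : H) : TensorProduct.comm R H H (D.comul h) = D.comul h :=
  D.pairing_ext fun f g => by rw [pairing_comm, pairing_comul, pairing_comul, mul_comm]

theorem slice_slice_assoc_rTensor_comul {N : Type*} [AddCommGroup N] [Module R N] (f g : R)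
    (z : H ⊗[R] N) : D.slice N g (D.slice (H ⊗[R] N) f
      (TensorProduct.assoc R H H N (D.comul.rTensor N z))) = D.slice N (f * g) z := by
  have : D.slice N g ∘ₗ D.slice (H ⊗[R] N) f ∘ₗ (TensorProduct.assoc R H H N).toLinearMap ∘ₗ
      D.comul.rTensor N = D.slice N (f * g) :=
    TensorProduct.ext' fun x y => by simp [slice_slice_assoc_tmul, pairing_comul]
  exact LinearMap.congr_fun this z

theorem comul_coassoc (h : H) : TensorProduct.assoc R H H H (D.comul.rTensor H (D.comul h)) =
    D.comul.lTensor H (D.comul h) :=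
  D.slice_ext fun f => D.slice_ext fun g => D.ext fun k => by
    rw [slice_slice_assoc_rTensor_comul, slice_lTensor, apply_slice_comul, apply_slice_comul,
      apply_slice_comul, mul_assoc]

theorem rTensor_evalAt_one_comul (h : H) : (D.evalAt 1).rTensor H (D.comul h) = 1 ⊗ₜ h :=
  (TensorProduct.lid R H).injective ((D.slice_one_comul h).trans (by simp))

/-- The coalgebra structure dual to the algebra structure of `R`. -/
abbrev coalgebra : Coalgebra R H where
  comul := D.comul
  counit := D.evalAt 1
  coassoc := LinearMap.ext D.comul_coassoc
  rTensor_counit_comp_comul := LinearMap.ext D.rTensor_evalAt_one_comul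
  lTensor_counit_comp_comul := LinearMap.ext fun h => by
    rw [LinearMap.comp_apply, ← D.comm_comul, LinearMap.lTensor, TensorProduct.map_comm]
    exact (congrArg _ (D.rTensor_evalAt_one_comul h)).trans (TensorProduct.comm_tmul _ _ _ _ _)

end Coalgebra

section Bialgebroid

variable {R' R H ι : Type*} [CommRing R'] [CommRing R] [Algebra R' R] [Ring H] [Module R H]
  [IsScalarTower R H H] [Fintype ι] {ρ : H →+* Module.End R' R} {a : ι → R} {c : ι → H}

variable (D : IsDualBasisRep ρ a c)

theorem pairing_rTensor_mulRight (f g r : R) (z : H ⊗[R] H) :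
    D.pairing f g ((LinearMap.mulRight R (r • (1 : H))).rTensor H z) = D.pairing (r * f) g z := by
  have : D.pairing f g ∘ₗ (LinearMap.mulRight R (r • (1 : H))).rTensor H = D.pairing (r * f) g :=
    TensorProduct.ext' fun x y => by
      rw [LinearMap.comp_apply, LinearMap.rTensor_tmul, pairing_tmul, pairing_tmul,
        LinearMap.mulRight_apply, D.mul_smul_one_apply]
  exact LinearMap.congr_fun this z

theorem pairing_lTensor_mulRight (f g r : R) (z : H ⊗[R] H) :
    D.pairing f g ((LinearMap.mulRight R (r • (1 : H))).lTensor H z) = D.pairing f (r * g) z := by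
  rw [← apply_slice, slice_lTensor, LinearMap.mulRight_apply, D.mul_smul_one_apply, apply_slice]

theorem comul_mem_takeuchi (h : H) : D.comul h ∈ takeuchi R H := fun r =>
  D.pairing_ext fun f g => by
    rw [pairing_rTensor_mulRight, pairing_lTensor_mulRight, pairing_comul, pairing_comul,
      mul_left_comm, mul_assoc]

theorem pairing_takeuchiAct_tmul (f g : R) (x : takeuchi R H) (y z : H) :
    D.pairing f g (takeuchiAct x (y ⊗ₜ[R] z)) = D.pairing (ρ y f) (ρ z g) x.1 := by
  have : D.pairing f g ∘ₗ TensorProduct.map (orbitMap R H y) (orbitMap R H z) =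
      D.pairing (ρ y f) (ρ z g) := TensorProduct.ext' fun u v => by simp
  exact LinearMap.congr_fun this x.1

theorem pairing_takeuchiAct_comul (f k : R) (g : H) (z : H ⊗[R] H) :
    D.pairing f k (takeuchiAct ⟨D.comul g, D.comul_mem_takeuchi g⟩ z) = ρ g (D.pairing f k z) := by
  induction z with
  | zero => simp
  | add u v hu hv => simp only [map_add, hu, hv]
  | tmul x y => rw [pairing_takeuchiAct_tmul, pairing_comul, pairing_tmul]

/-- The bialgebroid structure dual to the algebra structure of `R`. -/
def bialgebroid : Bialgebroid R H where
  toCoalgebra := D.coalgebra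
  comul_mem := D.comul_mem_takeuchi
  comul_one := D.pairing_ext fun f g => (D.pairing_comul f g 1).trans (by simp)
  comul_mul g h := D.pairing_ext fun f k =>
    (D.pairing_comul f k (g * h)).trans <| by
      refine .trans ?_ (D.pairing_takeuchiAct_comul f k g (D.comul h)).symm
      rw [pairing_comul, map_mul ρ, Module.End.mul_apply]
  counit_mul g h r := by
    change ρ (g * h * (r • (1 : H))) 1 = ρ (g * (ρ (h * (r • (1 : H))) 1 • (1 : H))) 1
    rw [D.mul_smul_one_apply, D.mul_smul_one_apply, D.mul_smul_one_apply, map_mul ρ,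
      Module.End.mul_apply, mul_one, mul_one]
  counit_smul_one r r' := by
    change ρ ((r • (1 : H)) * (r' • (1 : H))) 1 = r * r'
    rw [D.mul_smul_one_apply, D.smul_apply, map_one, Module.End.one_apply, mul_one]

theorem bialgebroid_comul (h : H) : D.bialgebroid.comul h = D.comul h := rfl

theorem isCocomm_bialgebroid : D.bialgebroid.IsCocomm := ⟨D.comm_comul⟩

end Bialgebroid

end IsDualBasisRep

end DualBasis

section Retraction

variable {R' R N : Type*} [CommRing R'] [CommRing R] [Algebra R' R] [AddCommGroup N] [Module R' N]

theorem rTensor_algebraLinearMap_comp (τ : R →ₗ[R'] R') (z : R ⊗[R'] N) :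
    (Algebra.linearMap R' R ∘ₗ τ).rTensor N z = 1 ⊗ₜ TensorProduct.lid R' N (τ.rTensor N z) := by
  induction z with
  | zero => simp
  | add y z hy hz => simp only [map_add, hy, hz, TensorProduct.tmul_add]
  | tmul r x => simp [Algebra.algebraMap_eq_smul_one, TensorProduct.smul_tmul]

theorem lid_rTensor_tmul_of_eq_one {P : Type*} [AddCommGroup P] [Module R' P] {τ : P →ₗ[R'] R'}
    {p : P} (hτ : τ p = 1) (x : N) : TensorProduct.lid R' N (τ.rTensor N (p ⊗ₜ x)) = x := by
  simp [hτ]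

theorem faithful_repTensor {R' P H : Type u} [CommRing R'] [AddCommGroup P] [Module R' P] [Ring H]
    (ρ : H →+* Module.End R' P) {τ : P →ₗ[R'] R'} {p : P} (hτ : τ p = 1) :
    (repTensor ρ).Faithful where
  map_injective {N N'} f g h := by
    refine ModuleCat.hom_ext (LinearMap.ext fun x => ?_)
    have h1 : f.hom.lTensor P (p ⊗ₜ[R'] x) = g.hom.lTensor P (p ⊗ₜ[R'] x) :=
      congrArg (fun φ => ModuleCat.Hom.hom φ (p ⊗ₜ[R'] x)) h
    rw [LinearMap.lTensor_tmul, LinearMap.lTensor_tmul] at h1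
    rw [← lid_rTensor_tmul_of_eq_one hτ (f.hom x), h1, lid_rTensor_tmul_of_eq_one hτ]

end Retraction

namespace IsDualBasisRep

section Horizontal

variable {R' R H ι : Type*} [CommRing R'] [CommRing R] [Algebra R' R] [Ring H] [Module R H]
  [Fintype ι] {ρ : H →+* Module.End R' R} {a : ι → R} {c : ι → H}

theorem mul_dual (D : IsDualBasisRep ρ a c) (h : H) (i : ι) : h * c i = ρ h 1 • c i :=
  D.ext fun f => by
    rw [map_mul, Module.End.mul_apply, D.smul_apply, ← one_mul (ρ (c i) f), D.map_mul_apply,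
      one_mul]

theorem mul_algebraMap_smul_one (D : IsDualBasisRep ρ a c) (h : H) (k : R') :
    h * (algebraMap R' R k • (1 : H)) = algebraMap R' R k • h :=
  D.ext fun f => by
    rw [D.mul_smul_one_apply, D.smul_apply, ← Algebra.smul_def, ← Algebra.smul_def, map_smul]

variable {V : Type*} [AddCommGroup V] [Module H V] [Module R V] [IsScalarTower R H V]

theorem sum_smul_dual_smul (D : IsDualBasisRep ρ a c) (x : V) : ∑ i, a i • c i • x = x := by
  have h := congrArg (· • x) (D.eq_sum 1)
  simpa only [map_one, Module.End.one_apply, one_smul, Finset.sum_smul, smul_assoc] using h.symm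

variable [Module R' V] [IsScalarTower R' R V]

theorem smul_smul_comm (D : IsDualBasisRep ρ a c) (h : H) (k : R') (x : V) :
    h • k • x = k • h • x := by
  rw [← algebraMap_smul R k x, ← algebraMap_smul R k (h • x), ← smul_assoc _ h x,
    ← D.mul_algebraMap_smul_one, mul_smul, smul_assoc, one_smul]

variable (D : IsDualBasisRep ρ a c)

variable (V) in
/-- The `R'`-submodule of the elements of an `H`-module on which `H` acts through `h ↦ ρ h 1`, as
it does on `1 : R`. -/
def horizontal : Submodule R' V where
  carrier := {x | ∀ h : H, h • x = ρ h 1 • x}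
  zero_mem' h := by rw [smul_zero, smul_zero]
  add_mem' hx hy h := by rw [smul_add, smul_add, hx, hy]
  smul_mem' k x hx h := by rw [D.smul_smul_comm, hx, smul_comm]

theorem dual_smul_mem_horizontal (i : ι) (x : V) : c i • x ∈ D.horizontal V := fun h => by
  rw [← mul_smul, D.mul_dual, smul_assoc]

theorem smul_smul_horizontal (h : H) (r : R) (x : D.horizontal V) :
    h • r • (x : V) = ρ h r • (x : V) := by
  rw [← one_smul H (x : V), ← smul_assoc r, ← mul_smul, x.2, D.mul_smul_one_apply, mul_one,
    one_smul]

variable (V) in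
/-- The `i`-th coordinate of an `H`-module with respect to the dual basis. -/
def coord (i : ι) : V →ₗ[R'] D.horizontal V where
  toFun x := ⟨c i • x, D.dual_smul_mem_horizontal i x⟩
  map_add' _ _ := Subtype.ext (smul_add _ _ _)
  map_smul' _ _ := Subtype.ext (D.smul_smul_comm _ _ _)

variable (V) in
/-- The action map `r ⊗ x ↦ r • x`. -/
abbrev horizontalLift : R ⊗[R'] D.horizontal V →ₗ[R] V :=
  (D.horizontal V).subtype.liftBaseChange R

theorem horizontalLift_rTensor (h : H) (z : R ⊗[R'] D.horizontal V) :
    D.horizontalLift V ((ρ h).rTensor _ z) = h • D.horizontalLift V z := by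
  induction z with
  | zero => simp
  | add y z hy hz => simp only [map_add, smul_add, hy, hz]
  | tmul r x => simp [D.smul_smul_horizontal]

theorem horizontalLift_sum_tmul_coord (x : V) :
    D.horizontalLift V (∑ i, a i ⊗ₜ[R'] D.coord V i x) = x := by
  simpa [coord] using D.sum_smul_dual_smul x

theorem sum_tmul_coord_horizontalLift (z : R ⊗[R'] D.horizontal V) :
    ∑ i, a i ⊗ₜ[R'] D.coord V i (D.horizontalLift V z) = z := by
  induction z with
  | zero => simp
  | add y z hy hz => simp only [map_add, TensorProduct.tmul_add, Finset.sum_add_distrib, hy, hz]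
  | tmul r x =>
    conv_rhs => rw [← D.sum_mul_apply r, TensorProduct.sum_tmul]
    refine Finset.sum_congr rfl fun i _ => ?_
    obtain ⟨k, hk⟩ := D.apply_mem_range i r
    have hcoord : D.coord V i (r • (x : V)) = k • x := Subtype.ext <| by
      rw [Submodule.coe_smul, ← algebraMap_smul R k, hk]
      exact D.smul_smul_horizontal (c i) r x
    rw [LinearMap.liftBaseChange_tmul, Submodule.subtype_apply, hcoord, ← hk, mul_comm,
      ← Algebra.smul_def, TensorProduct.smul_tmul]

theorem bijective_horizontalLift : Function.Bijective (D.horizontalLift V) :=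
  Function.bijective_iff_has_inverse.2 ⟨fun x => ∑ i, a i ⊗ₜ[R'] D.coord V i x,
    D.sum_tmul_coord_horizontalLift, D.horizontalLift_sum_tmul_coord⟩

end Horizontal

section Descent

variable {R' R H ι : Type*} [CommRing R'] [CommRing R] [Algebra R' R] [Ring H] [Module R H]
  [Fintype ι] {ρ : H →+* Module.End R' R} {a : ι → R} {c : ι → H}
  {N N' : Type*} [AddCommGroup N] [Module R' N] [AddCommGroup N'] [Module R' N']

theorem rTensor_smul_one (D : IsDualBasisRep ρ a c) (r : R) (z : R ⊗[R'] N) :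
    (ρ (r • (1 : H))).rTensor N z = r • z := by
  induction z with
  | zero => simp
  | add y z hy hz => rw [map_add, hy, hz, smul_add]
  | tmul f x =>
    rw [LinearMap.rTensor_tmul, D.smul_apply, map_one, Module.End.one_apply,
      TensorProduct.smul_tmul', smul_eq_mul]

theorem eq_lTensor_of_equivariant (D : IsDualBasisRep ρ a c) {τ : R →ₗ[R'] R'} (hτ : τ 1 = 1)
    (φ : R ⊗[R'] N →+ R ⊗[R'] N')
    (hφ : ∀ h z, φ ((ρ h).rTensor N z) = (ρ h).rTensor N' (φ z)) :
    ∃ f : N →ₗ[R'] N', ∀ z, φ z = f.lTensor R z := by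
  have hsmul (r : R) (z : R ⊗[R'] N) : φ (r • z) = r • φ z := by
    rw [← D.rTensor_smul_one, hφ, D.rTensor_smul_one]
  let Φ : R ⊗[R'] N →ₗ[R] R ⊗[R'] N' := { φ with map_smul' := hsmul }
  let f : N →ₗ[R'] N' := (TensorProduct.lid R' N').toLinearMap ∘ₗ τ.rTensor N' ∘ₗ
    Φ.restrictScalars R' ∘ₗ TensorProduct.mk R' R N 1
  have hΦ (x : N) : Φ (1 ⊗ₜ x) = 1 ⊗ₜ f x := by
    have h := hφ (ofEnd a c (Algebra.linearMap R' R ∘ₗ τ)) (1 ⊗ₜ x)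
    rwa [D.apply_ofEnd, rTensor_algebraLinearMap_comp, rTensor_algebraLinearMap_comp,
      lid_rTensor_tmul_of_eq_one hτ] at h
  have hf : Φ = f.baseChange R := TensorProduct.AlgebraTensorModule.ext fun r x => by
    rw [← mul_one r, ← smul_eq_mul, ← TensorProduct.smul_tmul', map_smul, hΦ, map_smul,
      LinearMap.baseChange_tmul]
  exact ⟨f, fun z => LinearMap.congr_fun hf z⟩

end Descent

section Equivalence

variable {R' R H : Type u} {ι : Type*} [CommRing R'] [CommRing R] [Algebra R' R] [Ring H]
  [Module R H] [Fintype ι] {ρ : H →+* Module.End R' R} {a : ι → R} {c : ι → H}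

theorem full_repTensor (D : IsDualBasisRep ρ a c) {τ : R →ₗ[R'] R'} (hτ : τ 1 = 1) :
    (repTensor ρ).Full where
  map_surjective {N N'} φ := by
    obtain ⟨f, hf⟩ := D.eq_lTensor_of_equivariant hτ (N := N) (N' := N')
      (ModuleCat.Hom.hom φ).toAddMonoidHom (fun h z => (ModuleCat.Hom.hom φ).map_smul h z)
    exact ⟨ModuleCat.ofHom f, ModuleCat.hom_ext (LinearMap.ext fun z => (hf z).symm)⟩

theorem essSurj_repTensor [IsScalarTower R H H] (D : IsDualBasisRep ρ a c) :
    (repTensor ρ).EssSurj where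
  mem_essImage V := by
    let _ : Module R V := Module.compHom V (RingHom.smulOneHom : R →+* H)
    let _ : Module R' V := Module.compHom V (algebraMap R' R)
    have : IsScalarTower R H V := ⟨fun r h x => by
      change (r • h) • x = (r • (1 : H)) • h • x
      rw [← mul_smul, smul_one_mul]⟩
    have : IsScalarTower R' R V := ⟨fun k r x => by
      rw [Algebra.smul_def, mul_smul]
      rfl⟩
    let ψ : (repTensor ρ).obj (ModuleCat.of R' (D.horizontal V)) →ₗ[H] V :=
      { toFun := D.horizontalLift V
        map_add' := map_add _
        map_smul' := D.horizontalLift_rTensor }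
    exact ⟨_, ⟨(LinearEquiv.ofBijective ψ D.bijective_horizontalLift).toModuleIso⟩⟩

theorem isEquivalence_repTensor [IsScalarTower R H H] (D : IsDualBasisRep ρ a c)
    {τ : R →ₗ[R'] R'} (hτ : τ 1 = 1) : (repTensor ρ).IsEquivalence where
  faithful := faithful_repTensor ρ hτ
  full := D.full_repTensor hτ
  essSurj := D.essSurj_repTensor

end Equivalence

end IsDualBasisRep

noncomputable section Monoidal

namespace IsDualBasisRep

variable {R' R H : Type u} {ι : Type*} [CommRing R'] [CommRing R] [Algebra R' R] [Ring H]
  [Module R H] [IsScalarTower R H H] [Fintype ι] {ρ : H →+* Module.End R' R} {a : ι → R}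
  {c : ι → H} (D : IsDualBasisRep ρ a c)

/-- The functor `N ↦ R ⊗[R'] N`. -/
abbrev baseChange : ModuleCat.{u} R' ⥤ D.bialgebroid.Mod := D.bialgebroid.repTensor ρ

/-- The `R`-action on `R ⊗[R'] N` obtained through `H` is the usual one. -/
def baseChangeEquiv (N : ModuleCat.{u} R') :
    (R ⊗[R'] N) ≃ₗ[R] D.bialgebroid.res.obj (D.baseChange.obj N) where
  toFun z := z
  invFun z := z
  left_inv _ := rfl
  right_inv _ := rfl
  map_add' _ _ := rfl
  map_smul' r z := (D.rTensor_smul_one r z).symm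

theorem smul_baseChangeEquiv (N : ModuleCat.{u} R') (h : H) (z : R ⊗[R'] N) :
    h • D.baseChangeEquiv N z = D.baseChangeEquiv N ((ρ h).rTensor N z) := rfl

theorem baseChange_hom_ext {N : ModuleCat.{u} R'} {Z : D.bialgebroid.Mod}
    {f g : D.baseChange.obj N ⟶ Z}
    (h : ∀ x : N, D.bialgebroid.res.map f (D.baseChangeEquiv N ((1 : R) ⊗ₜ[R'] x)) =
      D.bialgebroid.res.map g (D.baseChangeEquiv N ((1 : R) ⊗ₜ[R'] x))) : f = g := by
  refine D.bialgebroid.res.map_injective (ModuleCat.hom_ext (LinearMap.ext fun z => ?_))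
  obtain ⟨z, rfl⟩ := (D.baseChangeEquiv N).surjective z
  induction z with
  | zero => simp only [map_zero]
  | add y z hy hz => simp only [map_add, hy, hz]
  | tmul r x =>
    have e : r ⊗ₜ[R'] x = r • ((1 : R) ⊗ₜ[R'] x) := by
      rw [TensorProduct.smul_tmul', smul_eq_mul, mul_one]
    rw [e, map_smul, map_smul, map_smul]
    exact congrArg (r • ·) (h x)

theorem baseChange_tensor_hom_ext {N N' : ModuleCat.{u} R'} {Z : D.bialgebroid.Mod}
    {f g : D.baseChange.obj (N ⊗ N') ⟶ Z}
    (h : ∀ (x : N) (y : N'),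
      D.bialgebroid.res.map f (D.baseChangeEquiv (N ⊗ N') ((1 : R) ⊗ₜ[R'] (x ⊗ₜ[R'] y))) =
      D.bialgebroid.res.map g (D.baseChangeEquiv (N ⊗ N') ((1 : R) ⊗ₜ[R'] (x ⊗ₜ[R'] y)))) :
    f = g := by
  refine D.baseChange_hom_ext fun z => ?_
  change N ⊗[R'] N' at z
  induction z with
  | zero =>
    rw [TensorProduct.tmul_zero]
    simp only [map_zero]
  | add y z hy hz =>
    rw [TensorProduct.tmul_add]
    simp only [map_add, hy, hz]
  | tmul x y => exact h x y

/-- `(R ⊗[R'] N) ⊗[R] (R ⊗[R'] N') ≃ R ⊗[R'] (N ⊗[R'] N')`. -/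
def baseChangeTensorEquiv (N N' : ModuleCat.{u} R') :
    D.bialgebroid.res.obj (D.baseChange.obj N ⊗ D.baseChange.obj N') ≃ₗ[R]
      D.bialgebroid.res.obj (D.baseChange.obj (N ⊗ N')) :=
  (D.bialgebroid.tensorResEquiv _ _).symm ≪≫ₗ
    TensorProduct.congr (D.baseChangeEquiv N).symm (D.baseChangeEquiv N').symm ≪≫ₗ
    (AlgebraTensorModule.distribBaseChange R' R N N').symm ≪≫ₗ D.baseChangeEquiv (N ⊗ N')

theorem baseChangeTensorEquiv_tmul (N N' : ModuleCat.{u} R') (z : R ⊗[R'] N) (z' : R ⊗[R'] N') :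
    D.baseChangeTensorEquiv N N' (D.bialgebroid.tensorResEquiv _ _
      (D.baseChangeEquiv N z ⊗ₜ D.baseChangeEquiv N' z')) =
    D.baseChangeEquiv (N ⊗ N')
      ((AlgebraTensorModule.distribBaseChange R' R N N').symm (z ⊗ₜ z')) := rfl

theorem baseChangeTensorEquiv_map_orbitMap (N N' : ModuleCat.{u} R') (r r' : R) (x : N) (y : N')
    (u : H ⊗[R] H) :
    D.baseChangeTensorEquiv N N' (D.bialgebroid.tensorResEquiv _ _
      (TensorProduct.map (orbitMap R H (D.baseChangeEquiv N (r ⊗ₜ x)))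
        (orbitMap R H (D.baseChangeEquiv N' (r' ⊗ₜ y))) u)) =
      D.baseChangeEquiv (N ⊗ N') (D.pairing r r' u ⊗ₜ[R'] (x ⊗ₜ[R'] y)) := by
  induction u with
  | zero => rw [map_zero, map_zero, map_zero, map_zero, TensorProduct.zero_tmul, map_zero]
  | add u v hu hv =>
    rw [map_add, map_add, map_add, map_add, TensorProduct.add_tmul, map_add, hu, hv]
  | tmul u v =>
    rw [TensorProduct.map_tmul, orbitMap_apply, orbitMap_apply, smul_baseChangeEquiv,
      smul_baseChangeEquiv, baseChangeTensorEquiv_tmul, LinearMap.rTensor_tmul,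
      LinearMap.rTensor_tmul, AlgebraTensorModule.distribBaseChange_symm_tmul, pairing_tmul]

theorem baseChangeTensorEquiv_smul_tmul_tmul (N N' : ModuleCat.{u} R') (h : H) (r r' : R) (x : N)
    (y : N') :
    D.baseChangeTensorEquiv N N' (h • D.bialgebroid.tensorResEquiv _ _
      (D.baseChangeEquiv N (r ⊗ₜ x) ⊗ₜ D.baseChangeEquiv N' (r' ⊗ₜ y))) =
      h • D.baseChangeTensorEquiv N N' (D.bialgebroid.tensorResEquiv _ _
        (D.baseChangeEquiv N (r ⊗ₜ x) ⊗ₜ D.baseChangeEquiv N' (r' ⊗ₜ y))) := by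
  rw [Bialgebroid.smul_tensorResEquiv, baseChangeTensorEquiv_map_orbitMap, bialgebroid_comul,
    pairing_comul, baseChangeTensorEquiv_tmul, AlgebraTensorModule.distribBaseChange_symm_tmul]
  exact (D.smul_baseChangeEquiv (N ⊗ N') h ((r * r') ⊗ₜ[R'] (x ⊗ₜ[R'] y))).symm

theorem baseChangeTensorEquiv_smul (N N' : ModuleCat.{u} R') (h : H)
    (w : D.bialgebroid.res.obj (D.baseChange.obj N ⊗ D.baseChange.obj N')) :
    D.baseChangeTensorEquiv N N' (h • w) = h • D.baseChangeTensorEquiv N N' w := by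
  refine D.bialgebroid.tensor_equivariant (D.baseChangeTensorEquiv N N').toModuleIso.hom
    (fun h x y => ?_) h w
  change D.baseChangeTensorEquiv N N' (h • D.bialgebroid.tensorResEquiv _ _ (x ⊗ₜ y)) =
    h • D.baseChangeTensorEquiv N N' (D.bialgebroid.tensorResEquiv _ _ (x ⊗ₜ y))
  obtain ⟨x, rfl⟩ := (D.baseChangeEquiv N).surjective x
  obtain ⟨y, rfl⟩ := (D.baseChangeEquiv N').surjective y
  induction x with
  | zero => simp only [map_zero, TensorProduct.zero_tmul, smul_zero]
  | add x x' hx hx' => simp only [map_add, TensorProduct.add_tmul, smul_add, hx, hx']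
  | tmul r x =>
    induction y with
    | zero => simp only [map_zero, TensorProduct.tmul_zero, smul_zero]
    | add y y' hy hy' => simp only [map_add, TensorProduct.tmul_add, smul_add, hy, hy']
    | tmul r' y => exact D.baseChangeTensorEquiv_smul_tmul_tmul N N' h r r' x y

/-- The tensorator of the functor `N ↦ R ⊗[R'] N`. -/
def baseChangeTensorIso (N₁ N₂ : ModuleCat.{u} R') :
    D.baseChange.obj N₁ ⊗ D.baseChange.obj N₂ ≅ D.baseChange.obj (N₁ ⊗ N₂) :=
  D.bialgebroid.liftIso (D.baseChangeTensorEquiv N₁ N₂).toModuleIso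
    (D.baseChangeTensorEquiv_smul N₁ N₂)

/-- `R ≃ R ⊗[R'] R'`. -/
def baseChangeUnitEquiv :
    D.bialgebroid.res.obj (𝟙_ D.bialgebroid.Mod) ≃ₗ[R]
      D.bialgebroid.res.obj (D.baseChange.obj (𝟙_ (ModuleCat.{u} R'))) :=
  D.bialgebroid.unitResEquiv.symm ≪≫ₗ (AlgebraTensorModule.rid R' R R).symm ≪≫ₗ
    D.baseChangeEquiv (𝟙_ (ModuleCat.{u} R'))

theorem baseChangeUnitEquiv_smul (h : H) (w : D.bialgebroid.res.obj (𝟙_ D.bialgebroid.Mod)) :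
    D.baseChangeUnitEquiv (h • w) = h • D.baseChangeUnitEquiv w := by
  obtain ⟨r, rfl⟩ := D.bialgebroid.unitResEquiv.surjective w
  have h1 : h • D.bialgebroid.unitResEquiv r = D.bialgebroid.unitResEquiv (ρ h r) := by
    change ρ (h * (r • (1 : H))) 1 = ρ h r
    rw [D.mul_smul_one_apply, mul_one]
  rw [h1]
  rfl

/-- The unit comparison of the functor `N ↦ R ⊗[R'] N`. -/
def baseChangeUnitIso :
    𝟙_ D.bialgebroid.Mod ≅ D.baseChange.obj (𝟙_ (ModuleCat.{u} R')) :=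
  D.bialgebroid.liftIso D.baseChangeUnitEquiv.toModuleIso D.baseChangeUnitEquiv_smul

theorem baseChange_associativity (X Y Z : ModuleCat.{u} R') :
    (D.baseChangeTensorIso (X ⊗ Y) Z).inv ≫
        (D.baseChangeTensorIso X Y).inv ▷ D.baseChange.obj Z ≫
        (α_ (D.baseChange.obj X) (D.baseChange.obj Y) (D.baseChange.obj Z)).hom =
      D.baseChange.map (α_ X Y Z).hom ≫ (D.baseChangeTensorIso X (Y ⊗ Z)).inv ≫
        D.baseChange.obj X ◁ (D.baseChangeTensorIso Y Z).inv := by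
  refine D.baseChange_tensor_hom_ext fun w z => ?_
  change X ⊗[R'] Y at w
  induction w with
  | zero => rw [TensorProduct.zero_tmul, TensorProduct.tmul_zero]; simp only [map_zero]
  | add w w' hw hw' =>
    rw [TensorProduct.add_tmul, TensorProduct.tmul_add]
    simp only [map_add, hw, hw']
  | tmul x y => rfl

theorem baseChange_left_unitality (X : ModuleCat.{u} R') :
    (λ_ (D.baseChange.obj X)).inv = D.baseChange.map (λ_ X).inv ≫
      (D.baseChangeTensorIso (𝟙_ _) X).inv ≫ D.baseChangeUnitIso.inv ▷ D.baseChange.obj X := by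
  refine D.baseChange_hom_ext fun x => ?_
  change D.bialgebroid.tensorResEquiv (𝟙_ D.bialgebroid.Mod) (D.baseChange.obj X)
      (D.bialgebroid.unitResEquiv 1 ⊗ₜ D.baseChangeEquiv X ((1 : R) ⊗ₜ[R'] x)) =
    D.bialgebroid.tensorResEquiv (𝟙_ D.bialgebroid.Mod) (D.baseChange.obj X)
      (D.bialgebroid.unitResEquiv ((1 : R') • (1 : R)) ⊗ₜ
        D.baseChangeEquiv X ((1 : R) ⊗ₜ[R'] x))
  rw [one_smul]

theorem baseChange_right_unitality (X : ModuleCat.{u} R') :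
    (ρ_ (D.baseChange.obj X)).inv = D.baseChange.map (ρ_ X).inv ≫
      (D.baseChangeTensorIso X (𝟙_ _)).inv ≫ D.baseChange.obj X ◁ D.baseChangeUnitIso.inv := by
  refine D.baseChange_hom_ext fun x => ?_
  change D.bialgebroid.tensorResEquiv (D.baseChange.obj X) (𝟙_ D.bialgebroid.Mod)
      (D.baseChangeEquiv X ((1 : R) ⊗ₜ[R'] x) ⊗ₜ D.bialgebroid.unitResEquiv 1) =
    D.bialgebroid.tensorResEquiv (D.baseChange.obj X) (𝟙_ D.bialgebroid.Mod)
      (D.baseChangeEquiv X ((1 : R) ⊗ₜ[R'] x) ⊗ₜ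
        D.bialgebroid.unitResEquiv ((1 : R') • (1 : R)))
  rw [one_smul]

instance monoidalBaseChange : D.baseChange.Monoidal :=
  Functor.CoreMonoidal.toMonoidal <|
    .mk' (F := D.baseChange) D.baseChangeUnitIso D.baseChangeTensorIso
      (fun _ _ => D.baseChange_tensor_hom_ext fun _ _ => rfl)
      (fun _ _ => D.baseChange_tensor_hom_ext fun _ _ => rfl)
      D.baseChange_associativity D.baseChange_left_unitality D.baseChange_right_unitality

theorem baseChange_braided [D.bialgebroid.IsCocomm] (X Y : ModuleCat.{u} R') :
    (D.baseChangeTensorIso X Y).hom ≫ D.baseChange.map (β_ X Y).hom =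
      (β_ (D.baseChange.obj X) (D.baseChange.obj Y)).hom ≫ (D.baseChangeTensorIso Y X).hom := by
  rw [← Iso.eq_inv_comp, ← Category.assoc, ← Iso.comp_inv_eq]
  exact D.baseChange_tensor_hom_ext fun x y => rfl

instance braidedBaseChange [D.bialgebroid.IsCocomm] : D.baseChange.Braided where
  braided := D.baseChange_braided

end IsDualBasisRep

end Monoidal

theorem exists_eq_sum_mul_mul_of_mem_span_singleton {A : Type*} [Ring A] {x d : A}
    (hx : x ∈ TwoSidedIdeal.span {d}) :
    ∃ (n : ℕ) (y z : Fin n → A), x = ∑ i, y i * d * z i := by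
  rw [TwoSidedIdeal.mem_span_iff_mem_addSubgroup_closure,
    ← Submodule.span_int_eq_addSubgroupClosure, Submodule.mem_toAddSubgroup,
    Submodule.mem_span_set'] at hx
  obtain ⟨n, k, w, rfl⟩ := hx
  choose yd hyd z _ hw using fun i => Set.mem_mul.mp (w i).2
  choose y _ d' hd' hy using fun i => Set.mem_mul.mp (hyd i)
  refine ⟨n, fun i => k i • y i, z, Finset.sum_congr rfl fun i _ => ?_⟩
  rw [← hw, ← hy, Set.mem_singleton_iff.mp (hd' i), smul_mul_assoc, smul_mul_assoc]

section CoxeterDualBasis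

open NilHecke

variable {B : Type u} {M : CoxeterMatrix B} {W : Type v} [Group W] (cs : CoxeterSystem M W)

theorem exists_del_mul_eq_zero_and_nilHeckeRep_eq_one [Finite W] :
    ∃ (d : NilHecke M) (f : SymR B), (∀ s, del M s * d = 0) ∧ nilHeckeRep cs d f = 1 := by
  have := Fintype.ofFinite W
  obtain ⟨w₀, hw₀⟩ := Finite.exists_max cs.length
  obtain ⟨ω, hω, rfl⟩ := cs.exists_isReduced w₀
  have hd (s : B) : del M s * (ω.map (del M)).prod = 0 := by
    rw [← List.prod_cons, ← List.map_cons]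
    refine prod_map_del_eq_zero_of_length_lt cs fun w => ?_
    rw [List.length_cons, ← hω.eq]
    exact Nat.lt_succ_of_le (hw₀ w)
  have hρ : nilHeckeRep cs (ω.map (del M)).prod = (ω.map (demazure cs)).prod := by
    rw [map_list_prod, List.map_map]
    exact congrArg List.prod (List.map_congr_left fun s _ => nilHeckeRep_del cs s)
  obtain ⟨f, hf⟩ := exists_prod_map_demazure_eq_card cs hω fun s => by
    rw [← hρ, ← nilHeckeRep_del, ← map_mul, hd, map_zero]
  refine ⟨_, (Fintype.card W : ℝ)⁻¹ • f, hd, ?_⟩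
  rw [LinearMap.map_smul_of_tower, hρ, hf, ← map_natCast (algebraMap ℝ (SymR B)),
    Algebra.algebraMap_eq_smul_one, inv_smul_smul₀ (by simp)]

theorem nilHeckeRep_apply_mem_invariants {d : NilHecke M} (hd : ∀ s, del M s * d = 0)
    (f : SymR B) : nilHeckeRep cs d f ∈ invariants cs :=
  mem_invariants_of_demazure_eq_zero cs fun s => by
    rw [← nilHeckeRep_del, ← Module.End.mul_apply, ← map_mul, hd, map_zero, LinearMap.zero_apply]

theorem mul_eq_nilHeckeRep_one_smul {d : NilHecke M} (hd : ∀ s, del M s * d = 0)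
    (h : NilHecke M) : h * d = nilHeckeRep cs h 1 • d := by
  rw [smul_def, ← smul_eq_mul, ← smul_eq_mul, ← smul_ofSym_smul cs hd, map_one, one_smul]

theorem exists_isDualBasisRep_nilHeckeRep [Finite W] :
    ∃ (n : ℕ) (a : Fin n → SymR B) (c : Fin n → NilHecke M),
      IsDualBasisRep (nilHeckeRep cs).toRingHom a c := by
  obtain ⟨d, f, hd, hf⟩ := exists_del_mul_eq_zero_and_nilHeckeRep_eq_one cs
  have hmem : d * ofSym M f ∈ TwoSidedIdeal.span {d} :=
    TwoSidedIdeal.mul_mem_right _ _ _ (TwoSidedIdeal.subset_span rfl)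
  have hone : (1 : NilHecke M) ∈ TwoSidedIdeal.span {d} := by
    refine one_mem_of_nilHeckeRep_one_eq cs hmem ?_
    rw [map_mul, Module.End.mul_apply, nilHeckeRep_ofSym, mul_one, hf]
  obtain ⟨n, y, z, h1⟩ := exists_eq_sum_mul_mul_of_mem_span_singleton hone
  refine ⟨n, fun i => nilHeckeRep cs (y i) 1, fun i => d * z i, nilHeckeRep_smul cs,
    fun i g => ?_, fun h => ?_⟩
  · exact ⟨⟨_, nilHeckeRep_apply_mem_invariants cs
      (fun s => by rw [← mul_assoc, hd, zero_mul]) g⟩, rfl⟩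
  · calc h = ∑ i, (h * y i * d) * z i := by
          conv_lhs => rw [← mul_one h, h1, Finset.mul_sum]
          simp only [mul_assoc]
      _ = ∑ i, nilHeckeRep cs h (nilHeckeRep cs (y i) 1) • (d * z i) := by
          simp only [mul_eq_nilHeckeRep_one_smul cs hd, smul_mul_assoc, map_mul,
            Module.End.mul_apply]

theorem exists_linearMap_invariants_one_eq_one [Finite W] :
    ∃ τ : SymR B →ₗ[invariants cs] invariants cs, τ 1 = 1 := by
  obtain ⟨d, f, hd, hf⟩ := exists_del_mul_eq_zero_and_nilHeckeRep_eq_one cs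
  let τ : SymR B →ₗ[invariants cs] invariants cs :=
    { toFun := fun g => ⟨nilHeckeRep cs d (f * g), nilHeckeRep_apply_mem_invariants cs hd _⟩
      map_add' := fun g g' => Subtype.ext <|
        (congrArg (nilHeckeRep cs d) (mul_add f g g')).trans (map_add _ _ _)
      map_smul' := fun r g => Subtype.ext <|
        (congrArg (nilHeckeRep cs d) (mul_smul_comm r f g)).trans (map_smul _ _ _) }
  exact ⟨τ, Subtype.ext (by simpa [τ] using hf)⟩

namespace IsDualBasisRep

variable {cs} {ι : Type*} [Fintype ι] {a : ι → SymR B} {c : ι → NilHecke M}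
  (D : IsDualBasisRep (nilHeckeRep cs).toRingHom a c)

theorem comul_weight (l : B →₀ ℝ) : D.comul (weight M l) = weight M l ⊗ₜ 1 :=
  D.pairing_ext fun f g => by simp [pairing_comul, nilHeckeRep_weight, weightMul_apply, mul_assoc]

theorem comul_del (s : B) :
    D.comul (del M s) = del M s ⊗ₜ reflElt M s + 1 ⊗ₜ del M s :=
  D.pairing_ext fun f g => by
    simp only [pairing_comul, map_add, pairing_tmul, AlgHom.toRingHom_eq_coe, RingHom.coe_coe,
      nilHeckeRep_del, nilHeckeRep_reflElt, map_one, Module.End.one_apply]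
    rw [mul_comm f, demazure_mul]
    ring

end IsDualBasisRep

end CoxeterDualBasis

theorem mainTheorem3 {B : Type u} {M : CoxeterMatrix B} {W : Type v} [Group W] [Finite W]
    (cs : CoxeterSystem M W) :
    ∃ (ρ : NilHecke M →ₐ[ℝ] Module.End (invariants cs) (SymR B))
      (bd : Bialgebroid (SymR B) (NilHecke M)) (_ : bd.IsCocomm),
      (∀ (l : B →₀ ℝ) (f : SymR B),
        ρ (NilHecke.weight M l) f = SymmetricAlgebra.ι ℝ (B →₀ ℝ) l * f) ∧
      (∀ (s : B) (f : SymR B),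
        SymmetricAlgebra.ι ℝ (B →₀ ℝ) (simpleRoot s) * ρ (NilHecke.del M s) f =
          f - symAction cs (cs.simple s) f) ∧
      (∀ l : B →₀ ℝ, bd.comul (NilHecke.weight M l) = NilHecke.weight M l ⊗ₜ[SymR B] 1) ∧
      (∀ s : B, bd.comul (NilHecke.del M s) =
        NilHecke.del M s ⊗ₜ[SymR B] NilHecke.reflElt M s + 1 ⊗ₜ[SymR B] NilHecke.del M s) ∧
      (∀ h : NilHecke M, bd.counit h = ρ h 1) ∧
      Function.Bijective ρ ∧
      (∀ (h : NilHecke M) (n : ℕ) (x y : Fin n → NilHecke M),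
        bd.comul h = ∑ i, x i ⊗ₜ[SymR B] y i →
          ∀ f g : SymR B, ρ h (f * g) = ∑ i, ρ (x i) f * ρ (y i) g) ∧
      (bd.repTensor ρ.toRingHom).IsEquivalence ∧
      Nonempty (bd.repTensor ρ.toRingHom).Braided := by
  obtain ⟨n, a, c, D⟩ := exists_isDualBasisRep_nilHeckeRep cs
  obtain ⟨τ, hτ⟩ := exists_linearMap_invariants_one_eq_one cs
  have hcocomm : D.bialgebroid.IsCocomm := D.isCocomm_bialgebroid
  refine ⟨nilHeckeRep cs, D.bialgebroid, hcocomm, fun l f => ?_, fun s f => ?_, D.comul_weight,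
    D.comul_del, fun h => rfl, D.bijective, fun h n x y hxy f g => ?_,
    D.isEquivalence_repTensor hτ, ⟨D.braidedBaseChange⟩⟩
  · rw [nilHeckeRep_weight, weightMul_apply]
  · rw [nilHeckeRep_del, ι_mul_demazure]
  · calc nilHeckeRep cs h (f * g) = D.pairing f g (D.comul h) := (D.pairing_comul f g h).symm
      _ = ∑ i, D.pairing f g (x i ⊗ₜ y i) := by rw [← D.bialgebroid_comul, hxy, map_sum]
      _ = ∑ i, nilHeckeRep cs (x i) f * nilHeckeRep cs (y i) g :=
        Finset.sum_congr rfl fun i _ => D.pairing_tmul f g (x i) (y i)
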